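/- Let $T$ be a finite tree with at least three vertices; its boundary is the set $\delta\Omega$ of its leaves. A real number $\lambda\ge 0$ is a Steklov eigenvalue of $T$ if there is a function $f\not\equiv 0$ on $V(T)$ with $\sum_{w\sim v}(f(v)-f(w))=0$ at every non-leaf $v$ and $f(\omega)-f(\omega')=\lambda f(\omega)$ at every leaf $\omega$, where $\omega'$ is the unique neighbor of $\omega$. Let $\lambda_2(T)$ be the smallest positive Steklov eigenvalue of $T$. For integers $r\ge1$, $b\ge2$, $c\ge1$ and $0\le t\le b-2$, let $\mathrm{AS}(r,b,c,t)$ (a generalized almost seesaw tree) be the tree obtained by gluing $b$ paths together at one common endpoint, where one path has length $r+1$, one has length $r$, $t$ have length $c+1$, and $b-2-t$ have length $c$. Let $r\ge1$, $D=2r+1$, $n\ge D+1$, $M=n-2r-2$ and $s=\lceil r/2\rceil$. Consider the maximum of $\lambda_2(T)$ over all trees $T$ with $n$ vertices and diameter $D$; uniqueness of a maximizer is always meant up to isomorphism. 1. If $M=0$, the path $P_{D+1}$ on $D+1$ vertices is the unique maximizer. 2. If $M\ge1$, put $q_-=\max\{1,\lfloor M/s\rfloor\}$, $q_+=\lceil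 M/s\rceil$, and write $M=q_\pm c_\pm+t_\pm$ with integers $c_\pm$ and $0\le t_\pm<q_\pm$. Then $\mathrm{AS}(r,q_-+2,c_-,t_-)$ and $\mathrm{AS}(r,q_++2,c_+,t_+)$ have order $n$ and diameter $D$, and $$\max_{|V(T)|=n,\ \operatorname{diam}T=D}\lambda_2(T)=\max\bigl\{\lambda_2(\mathrm{AS}(r,q_-+2,c_-,t_-)),\ \lambda_2(\mathrm{AS}(r,q_++2,c_+,t_+))\bigr\}.$$ Every maximizer is isomorphic to one of these two trees. If the two values on the right differ, then the maximizer is unique (namely the one of the two trees with the larger value). 3. For each fixed $r\ge1$ there is an $N$ such that for every $n\ge N$ the maximizer among trees of order $n$ and diameter $2r+1$ is unique. -/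

import Mathlib

open Classical in
/-- The discrete Laplacian `Δ f (v) = ∑_{w ∼ v} (f v - f w)`. -/
noncomputable def graphLaplacian {V : Type*} [Fintype V] (G : SimpleGraph V) (f : V → ℝ) (v : V) :
    ℝ :=
  ∑ w ∈ Finset.univ.filter (fun w => G.Adj v w), (f v - f w)

/-- A leaf: a vertex with exactly one neighbour. The set of leaves is the boundary. -/
def IsLeafVertex {V : Type*} (G : SimpleGraph V) (v : V) : Prop :=
  ∃! w, G.Adj v w

/-- Steklov eigenvalues of a finite graph with leaf boundary: there is a nontrivial function that is
harmonic at all interior (non-leaf) vertices and whose outward normal derivative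
`f ω - f ω'` (with `ω'` the unique neighbour of the leaf `ω`) equals `lam * f ω` at every leaf. -/
def IsSteklovEigenvalue {V : Type*} [Fintype V] (G : SimpleGraph V) (lam : ℝ) : Prop :=
  0 ≤ lam ∧ ∃ f : V → ℝ, f ≠ 0 ∧
    (∀ v, ¬ IsLeafVertex G v → graphLaplacian G f v = 0) ∧
    (∀ ω ω', IsLeafVertex G ω → G.Adj ω ω' → f ω - f ω' = lam * f ω)

/-- The first nonzero Steklov eigenvalue `λ₂`. The spectrum is a finite set of reals, so the infimum
is a minimum for every tree with at least two leaves that has an interior vertex; and as `0` is a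
simple eigenvalue of a tree, this is also the second eigenvalue counted with multiplicity. -/
noncomputable def steklovLambda2 {V : Type*} [Fintype V] (G : SimpleGraph V) : ℝ :=
  sInf {lam : ℝ | 0 < lam ∧ IsSteklovEigenvalue G lam}

/-- Trees of order `n` and diameter `D`. -/
def IsTreeOfOrderDiam {V : Type*} [Fintype V] (n D : ℕ) (G : SimpleGraph V) : Prop :=
  G.IsTree ∧ Fintype.card V = n ∧ G.diam = D

/-- `G` maximizes `λ₂` among trees of order `n` and diameter `D`. -/
def IsExtremizer {V : Type} [Fintype V] (n D : ℕ) (G : SimpleGraph V) : Prop :=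
  IsTreeOfOrderDiam n D G ∧
    ∀ (W : Type) [Fintype W] (H : SimpleGraph W), IsTreeOfOrderDiam n D H →
      steklovLambda2 H ≤ steklovLambda2 G

/-- `G` is, up to isomorphism, the only maximizer of `λ₂` among trees of order `n` and
diameter `D`. -/
def IsUniqueExtremizer {V : Type} [Fintype V] (n D : ℕ) (G : SimpleGraph V) : Prop :=
  IsExtremizer n D G ∧
    ∀ (W : Type) [Fintype W] (H : SimpleGraph W), IsExtremizer n D H → Nonempty (H ≃g G)

/-- The spider `S(ℓ₁, …, ℓ_b)`. The vertex `none` is the center, and `some ⟨i, j⟩` is the vertex at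
distance `j + 1` from the center on the `i`-th branch, which has `ℓᵢ` edges. -/
def spider (l : List ℕ) : SimpleGraph (Option (Σ i : Fin l.length, Fin (l.get i))) :=
  SimpleGraph.fromRel fun x y =>
    match x, y with
    | none, some ⟨_, j⟩ => (j : ℕ) = 0
    | some ⟨i, j⟩, some ⟨i', j'⟩ => i = i' ∧ (j : ℕ) + 1 = (j' : ℕ)
    | _, _ => False

/-- The branch lengths of `AS(r, b, c, t)`: one of length `r + 1`, one of length `r`, `t` of length
`c + 1`, and `b - 2 - t` of length `c`. -/
abbrev almostSeesawLengths (r b c t : ℕ) : List ℕ :=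
  (r + 1) :: r :: (List.replicate t (c + 1) ++ List.replicate (b - 2 - t) c)

/-- The generalized almost seesaw tree `AS(r, b, c, t)` (for `r ≥ 1`, `b ≥ 2`, `c ≥ 1` and
`0 ≤ t ≤ b - 2`). -/
abbrev almostSeesaw (r b c t : ℕ) := spider (almostSeesawLengths r b c t)

/-! A tree of diameter 2r+1 has a central edge ac; cutting it leaves two rooted trees of height r.
Following a highest child from every vertex decomposes them into descending paths: two through the
roots, with r+1 vertices each, and further ones with k₁, k₂, … vertices, where 1 ≤ kᵢ ≤ r and ∑ kᵢ =
M.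

Upper bound. Let 1/(r+1) < λ < 1/r, R(k) = λ/(1-λk) and p = R(r). Give the roots the values x and 1
and extend downwards as if each branch were a single path satisfying the Steklov condition at its
leaf. Energy minus λ times the leaf norm then telescopes along the paths and leaves (x-1)² - p(x²+1)
minus the sum of R(kᵢ)f(parent)². As |f| does not drop below its value at the root of its side, this
is nonpositive for every x once (p-1)(p-1+∑R(kᵢ)) ≥ 1, and x can be chosen so that f has zero mean
on the leaves. Hence λ₂ ≤ λ. Equality forces all further paths to hang from one root, so that the
tree is a spider with branches r+1, r, k₁, k₂, …; for such a spider λ₂ solves (p-1)(p-1+∑R(kᵢ)) = 1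
(`BicentralForest.steklovLambda2_le`, `spider_secular`).

Optimisation. Maximising λ₂ thus means minimising ∑R(kᵢ) over partitions of M into parts at most r.
R is convex, so for a given number of parts the balanced partition wins. The intercept of the chord
of R over [e, e+1] has the sign of 1-λ(2e+1), which tells whether extra parts cost or save; it
changes sign at part size about r/2, so only ⌊M/s⌋ and ⌈M/s⌉ parts remain (`sum_response_optimal`,
`steklovLambda2_le_max`).

Large orders. If s ∣ M the candidates coincide. Otherwise a tie makes λ₂ a root of one of finitely
many quadratics independent of M, while the secular equation bounds M in terms of λ₂; so ties stop
eventually (`exists_forall_steklovLambda2_ne`). -/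

/-! ### Dirichlet form, Green's formula and the variational characterisation of `λ₂`. -/

section Variational

open Finset Classical

variable {V : Type*} [Fintype V] {G : SimpleGraph V}

/-- The set of leaves of a finite graph. -/
noncomputable def leaves (G : SimpleGraph V) : Finset V := univ.filter (IsLeafVertex G)

theorem mem_leaves {v : V} : v ∈ leaves G ↔ IsLeafVertex G v := by simp [leaves]

/-- The Dirichlet form of a finite graph. -/
noncomputable def dirichletForm (G : SimpleGraph V) (f g : V → ℝ) : ℝ :=
  (1 / 2) * ∑ v, ∑ w, if G.Adj v w then (f v - f w) * (g v - g w) else 0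

/-- The `ℓ²` inner product on the leaves. -/
noncomputable def leafForm (G : SimpleGraph V) (f g : V → ℝ) : ℝ :=
  ∑ v ∈ leaves G, f v * g v

theorem graphLaplacian_eq (f : V → ℝ) (v : V) :
    graphLaplacian G f v = ∑ w, if G.Adj v w then f v - f w else 0 := by
  rw [graphLaplacian, sum_filter]

theorem graphLaplacian_leaf (f : V → ℝ) {v w : V} (hv : IsLeafVertex G v) (hw : G.Adj v w) :
    graphLaplacian G f v = f v - f w := by
  have : univ.filter (fun w => G.Adj v w) = {w} := by
    ext x
    simpa using ⟨fun h => hv.unique h hw, fun h => h ▸ hw⟩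
  rw [graphLaplacian]
  convert sum_singleton (fun w => f v - f w) w

/-- Green's formula. -/
theorem dirichletForm_eq_sum_laplacian (f g : V → ℝ) :
    dirichletForm G f g = ∑ v, graphLaplacian G f v * g v := by
  have h1 : ∑ v, ∑ w, (if G.Adj v w then (f v - f w) * (g v - g w) else 0) =
      ∑ v, ∑ w, (if G.Adj v w then (f v - f w) * g v else 0) +
      ∑ v, ∑ w, (if G.Adj v w then (f w - f v) * g w else 0) := by
    simp_rw [← sum_add_distrib]
    refine sum_congr rfl fun v _ => sum_congr rfl fun w _ => ?_
    split_ifs <;> ring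
  have h2 : ∑ v, ∑ w, (if G.Adj v w then (f w - f v) * g w else 0) =
      ∑ v, ∑ w, (if G.Adj v w then (f v - f w) * g v else 0) := by
    rw [sum_comm]
    simp_rw [G.adj_comm]
  rw [dirichletForm, h1, h2, ← two_mul, ← mul_assoc]
  norm_num
  refine sum_congr rfl fun v _ => ?_
  rw [graphLaplacian_eq, sum_mul]
  refine sum_congr rfl fun w _ => ?_
  split_ifs <;> simp

theorem dirichletForm_comm (f g : V → ℝ) : dirichletForm G f g = dirichletForm G g f := by
  simp_rw [dirichletForm, mul_comm]

theorem leafForm_comm (f g : V → ℝ) : leafForm G f g = leafForm G g f := by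
  simp_rw [leafForm, mul_comm]

theorem dirichletForm_add_right (f g h : V → ℝ) :
    dirichletForm G f (g + h) = dirichletForm G f g + dirichletForm G f h := by
  simp_rw [dirichletForm_eq_sum_laplacian, Pi.add_apply, mul_add, sum_add_distrib]

theorem dirichletForm_smul_right (t : ℝ) (f g : V → ℝ) :
    dirichletForm G f (t • g) = t * dirichletForm G f g := by
  simp_rw [dirichletForm_eq_sum_laplacian, Pi.smul_apply, smul_eq_mul, mul_sum]
  exact sum_congr rfl fun v _ => by ring

theorem leafForm_add_right (f g h : V → ℝ) :
    leafForm G f (g + h) = leafForm G f g + leafForm G f h := by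
  simp_rw [leafForm, Pi.add_apply, mul_add, sum_add_distrib]

theorem leafForm_smul_right (t : ℝ) (f g : V → ℝ) :
    leafForm G f (t • g) = t * leafForm G f g := by
  simp_rw [leafForm, Pi.smul_apply, smul_eq_mul, mul_sum]
  exact sum_congr rfl fun v _ => by ring

theorem dirichletForm_add_smul_self (t : ℝ) (f g : V → ℝ) :
    dirichletForm G (f + t • g) (f + t • g) =
      dirichletForm G f f + 2 * t * dirichletForm G f g + t ^ 2 * dirichletForm G g g := by
  rw [dirichletForm_add_right, dirichletForm_smul_right, dirichletForm_comm _ f,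
    dirichletForm_comm _ g, dirichletForm_add_right, dirichletForm_add_right,
    dirichletForm_smul_right, dirichletForm_smul_right, dirichletForm_comm g f]
  ring

theorem leafForm_add_smul_self (t : ℝ) (f g : V → ℝ) :
    leafForm G (f + t • g) (f + t • g) =
      leafForm G f f + 2 * t * leafForm G f g + t ^ 2 * leafForm G g g := by
  rw [leafForm_add_right, leafForm_smul_right, leafForm_comm _ f,
    leafForm_comm _ g, leafForm_add_right, leafForm_add_right,
    leafForm_smul_right, leafForm_smul_right, leafForm_comm g f]
  ring

theorem dirichletForm_self_nonneg (f : V → ℝ) : 0 ≤ dirichletForm G f f := by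
  refine mul_nonneg (by norm_num) (sum_nonneg fun v _ => sum_nonneg fun w _ => ?_)
  split_ifs
  · exact mul_self_nonneg _
  · exact le_rfl

theorem leafForm_self_nonneg (f : V → ℝ) : 0 ≤ leafForm G f f :=
  sum_nonneg fun _ _ => mul_self_nonneg _

/-- Only one of the two orderings of the edge is kept, hence the harmless factor 2. -/
theorem sq_sub_le_dirichletForm (f : V → ℝ) {x y : V} (h : G.Adj x y) :
    (f x - f y) ^ 2 ≤ 2 * dirichletForm G f f := by
  have key : ∀ v w, 0 ≤ if G.Adj v w then (f v - f w) * (f v - f w) else 0 := by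
    intro v w
    split_ifs
    · exact mul_self_nonneg _
    · exact le_rfl
  have h1 : ∑ w, (if G.Adj x w then (f x - f w) * (f x - f w) else 0) ≤
      ∑ v, ∑ w, (if G.Adj v w then (f v - f w) * (f v - f w) else 0) :=
    single_le_sum (f := fun v => ∑ w, if G.Adj v w then (f v - f w) * (f v - f w) else 0)
      (fun v _ => sum_nonneg fun w _ => key v w) (mem_univ x)
  have h2 : (if G.Adj x y then (f x - f y) * (f x - f y) else 0) ≤
      ∑ w, (if G.Adj x w then (f x - f w) * (f x - f w) else 0) :=
    single_le_sum (f := fun w => if G.Adj x w then (f x - f w) * (f x - f w) else 0)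
      (fun w _ => key x w) (mem_univ y)
  rw [if_pos h] at h2
  rw [dirichletForm]
  nlinarith

-- Besides controlling functions of small energy, this yields lower bounds for distances: exhibit a
-- function that changes by at most 1 along edges and compare its values.
omit [Fintype V] in
theorem abs_sub_le_mul_dist (hG : G.Connected) {f : V → ℝ} {C : ℝ}
    (hf : ∀ x y, G.Adj x y → |f x - f y| ≤ C) (x y : V) : |f x - f y| ≤ C * G.dist x y := by
  obtain ⟨p, hp⟩ := hG.exists_walk_length_eq_dist x y
  rw [← hp]
  clear hp
  induction p with
  | nil => simp
  | @cons u v w h p ih =>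
    have h1 := abs_sub_le (f u) (f v) (f w)
    have h2 := hf _ _ h
    rw [SimpleGraph.Walk.length_cons]
    push_cast
    linarith

theorem eq_of_dirichletForm_eq_zero (hG : G.Connected) {f : V → ℝ}
    (hf : dirichletForm G f f = 0) (x y : V) : f x = f y := by
  have := abs_sub_le_mul_dist (C := 0) hG (f := f) (fun x y h => by
    have := sq_sub_le_dirichletForm f h
    rw [hf] at this
    have h0 : f x - f y = 0 := by nlinarith
    simp [h0]) x y
  rw [zero_mul] at this
  linarith [abs_nonpos_iff.1 this]

theorem IsSteklovEigenvalue.form_eq {lam : ℝ} {f : V → ℝ}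
    (h1 : ∀ v, ¬ IsLeafVertex G v → graphLaplacian G f v = 0)
    (h2 : ∀ ω ω', IsLeafVertex G ω → G.Adj ω ω' → f ω - f ω' = lam * f ω) (g : V → ℝ) :
    dirichletForm G f g = lam * leafForm G f g := by
  rw [dirichletForm_eq_sum_laplacian, leafForm, leaves, sum_filter, mul_sum]
  refine sum_congr rfl fun v _ => ?_
  split_ifs with hv
  · obtain ⟨w, hw, -⟩ := id hv
    rw [graphLaplacian_leaf f hv hw, h2 v w hv hw, mul_assoc]
  · rw [h1 v hv]; simp

theorem dirichletForm_const_right (f : V → ℝ) (k : ℝ) :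
    dirichletForm G f (fun _ => k) = 0 := by
  simp [dirichletForm]

theorem leafForm_const_right (f : V → ℝ) (k : ℝ) :
    leafForm G f (fun _ => k) = (∑ v ∈ leaves G, f v) * k := by
  simp [leafForm, sum_mul]

theorem leafForm_pos_of_dirichletForm (hG : G.Connected) (hl : (leaves G).Nonempty) {f : V → ℝ}
    (hf : f ≠ 0) {lam : ℝ} (h : dirichletForm G f f ≤ lam * leafForm G f f) :
    0 < leafForm G f f := by
  refine lt_of_le_of_ne (leafForm_self_nonneg f) fun h0 => hf ?_
  rw [← h0, mul_zero] at h
  have hE := le_antisymm h (dirichletForm_self_nonneg f)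
  obtain ⟨ω, hω⟩ := hl
  have := (sum_eq_zero_iff_of_nonneg fun v _ => mul_self_nonneg (f v)).1 h0.symm ω hω
  ext v
  rw [eq_of_dirichletForm_eq_zero hG hE v ω]
  simpa using this

/-- A minimiser of the Rayleigh quotient on the functions of zero mean on the leaves exists. -/
theorem exists_rayleigh_minimizer (hG : G.Connected) (hl : 2 ≤ #(leaves G)) :
    ∃ f : V → ℝ, ∑ v ∈ leaves G, f v = 0 ∧ leafForm G f f = 1 ∧
      ∀ g : V → ℝ, ∑ v ∈ leaves G, g v = 0 →
        dirichletForm G f f * leafForm G g g ≤ dirichletForm G g g := by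
  obtain ⟨u, hu, w, hw, huw⟩ := one_lt_card.1 hl
  have scale : ∀ g : V → ℝ, ∑ v ∈ leaves G, g v = 0 → 0 < leafForm G g g →
      ∃ t : ℝ, 0 < t ∧ t ^ 2 * leafForm G g g = 1 := by
    intro g _ hg
    refine ⟨(Real.sqrt (leafForm G g g))⁻¹, by positivity, ?_⟩
    rw [inv_pow, Real.sq_sqrt hg.le, inv_mul_cancel₀ hg.ne']
  have smulE : ∀ (t : ℝ) (g : V → ℝ), dirichletForm G (t • g) (t • g) =
      t ^ 2 * dirichletForm G g g := by
    intro t g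
    rw [dirichletForm_smul_right, dirichletForm_comm, dirichletForm_smul_right]; ring
  have smulB : ∀ (t : ℝ) (g : V → ℝ), leafForm G (t • g) (t • g) =
      t ^ 2 * leafForm G g g := by
    intro t g
    rw [leafForm_smul_right, leafForm_comm, leafForm_smul_right]; ring
  have smulS : ∀ (t : ℝ) (g : V → ℝ), ∑ v ∈ leaves G, g v = 0 →
      ∑ v ∈ leaves G, (t • g) v = 0 := by
    intro t g hg
    simp [← mul_sum, hg]
  obtain ⟨f₀, hf₀, hB₀⟩ : ∃ f : V → ℝ, ∑ v ∈ leaves G, f v = 0 ∧ leafForm G f f = 1 := by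
    let g : V → ℝ := fun v => if v = u then 1 else if v = w then -1 else 0
    have hg : ∑ v ∈ leaves G, g v = 0 := by
      have : g = fun v => (if v = u then (1 : ℝ) else 0) - (if v = w then 1 else 0) := by
        ext v
        simp only [g]
        split_ifs with h1 h2
        · exact absurd (h1.symm.trans h2) huw
        all_goals norm_num
      rw [this, sum_sub_distrib]
      simp [hu, hw]
    have hgB : 0 < leafForm G g g :=
      sum_pos' (fun v _ => mul_self_nonneg _) ⟨u, hu, by simp [g]⟩
    obtain ⟨t, ht, h1⟩ := scale g hg hgB
    exact ⟨t • g, smulS t g hg, by rw [smulB, h1]⟩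
  have hEc : Continuous fun f : V → ℝ => dirichletForm G f f := by
    unfold dirichletForm
    refine continuous_const.mul (continuous_finsetSum _ fun v _ => continuous_finsetSum _
      fun w _ => ?_)
    split_ifs <;> fun_prop
  have hBc : Continuous fun f : V → ℝ => leafForm G f f := by
    unfold leafForm; fun_prop
  have hSc : Continuous fun f : V → ℝ => ∑ v ∈ leaves G, f v := by fun_prop
  -- The leaf norm does not see interior vertices, so its unit sphere may be unbounded; the cap on
  -- the energy restores compactness.
  let K : Set (V → ℝ) := {f | ∑ v ∈ leaves G, f v = 0 ∧ leafForm G f f = 1 ∧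
    dirichletForm G f f ≤ dirichletForm G f₀ f₀}
  have hKc : IsClosed K := by
    refine (isClosed_eq hSc continuous_const).inter ((isClosed_eq hBc continuous_const).inter ?_)
    exact isClosed_le hEc continuous_const
  have hKb : Bornology.IsBounded K := by
    set C := Real.sqrt (2 * dirichletForm G f₀ f₀)
    refine (Metric.isBounded_closedBall (x := (0 : V → ℝ)) (r := 1 + C * G.diam)).subset ?_
    rintro f ⟨-, hB, hE⟩
    rw [mem_closedBall_zero_iff, pi_norm_le_iff_of_nonneg (by positivity)]
    intro v
    have h1 : |f v - f u| ≤ C * G.dist v u := by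
      refine abs_sub_le_mul_dist hG (fun x y h => ?_) v u
      refine Real.abs_le_sqrt ((sq_sub_le_dirichletForm f h).trans ?_)
      linarith
    have h2 : |f u| ≤ 1 := by
      rw [← sq_le_one_iff_abs_le_one]
      have := single_le_sum (f := fun v => f v * f v) (fun v _ => mul_self_nonneg _) hu
      rw [leafForm] at hB
      rw [hB] at this
      nlinarith
    have h3 : (G.dist v u : ℝ) ≤ G.diam := by
      have : Nonempty V := ⟨u⟩
      exact_mod_cast SimpleGraph.dist_le_diam (SimpleGraph.connected_iff_ediam_ne_top.1 hG)
    have h4 := abs_add_le (f v - f u) (f u)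
    rw [sub_add_cancel] at h4
    have h5 : C * G.dist v u ≤ C * G.diam := mul_le_mul_of_nonneg_left h3 (Real.sqrt_nonneg _)
    rw [Real.norm_eq_abs]
    linarith
  obtain ⟨f, ⟨hfS, hfB, hfE⟩, hmin⟩ := (Metric.isCompact_of_isClosed_isBounded hKc hKb).exists_isMinOn
    ⟨f₀, hf₀, hB₀, le_rfl⟩ hEc.continuousOn
  refine ⟨f, hfS, hfB, fun g hg => ?_⟩
  rcases (leafForm_self_nonneg (G := G) g).eq_or_lt with h0 | h0
  · rw [← h0, mul_zero]; exact dirichletForm_self_nonneg g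
  obtain ⟨t, ht, h1⟩ := scale g hg h0
  have h2 : dirichletForm G f f ≤ dirichletForm G (t • g) (t • g) := by
    by_cases hle : dirichletForm G (t • g) (t • g) ≤ dirichletForm G f₀ f₀
    · exact hmin ⟨smulS t g hg, by rw [smulB, h1], hle⟩
    · exact hfE.trans (not_le.1 hle).le
  rw [smulE] at h2
  have h3 : 0 < t ^ 2 := by positivity
  have h4 : t ^ 2 * (dirichletForm G f f * leafForm G g g) ≤ t ^ 2 * dirichletForm G g g := by
    calc _ = dirichletForm G f f * (t ^ 2 * leafForm G g g) := by ring
      _ = dirichletForm G f f := by rw [h1, mul_one]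
      _ ≤ _ := h2
  exact le_of_mul_le_mul_left h4 h3

/-- First variation: near t = 0 the linear term dominates. -/
theorem eq_zero_of_forall_quadratic_nonneg {b c : ℝ} (h : ∀ t : ℝ, 0 ≤ 2 * t * b + t ^ 2 * c) :
    b = 0 := by
  by_contra hb
  rcases le_or_gt c 0 with hc | hc
  · have := h (-b)
    nlinarith [mul_self_pos.2 hb, mul_nonneg (sq_nonneg b) (neg_nonneg.2 hc)]
  · have := h (-b / c)
    have h2 : 2 * (-b / c) * b + (-b / c) ^ 2 * c = -(b * b / c) := by
      field_simp; ring
    rw [h2] at this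
    have := div_pos (mul_self_pos.2 hb) hc
    linarith

theorem IsSteklovEigenvalue.sum_leaves_eq_zero {lam : ℝ} (hlam : lam ≠ 0) {f : V → ℝ}
    (h1 : ∀ v, ¬ IsLeafVertex G v → graphLaplacian G f v = 0)
    (h2 : ∀ ω ω', IsLeafVertex G ω → G.Adj ω ω' → f ω - f ω' = lam * f ω) :
    ∑ v ∈ leaves G, f v = 0 := by
  have h := IsSteklovEigenvalue.form_eq h1 h2 (fun _ => 1)
  rw [dirichletForm_const_right, leafForm_const_right, mul_one] at h
  exact (mul_eq_zero.1 h.symm).resolve_left hlam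

/-- The variational characterisation of `λ₂`. -/
theorem steklovLambda2_spec (hG : G.Connected) (hl : 2 ≤ #(leaves G)) :
    0 < steklovLambda2 G ∧ IsSteklovEigenvalue G (steklovLambda2 G) ∧
      ∀ g : V → ℝ, ∑ v ∈ leaves G, g v = 0 →
        steklovLambda2 G * leafForm G g g ≤ dirichletForm G g g := by
  have hne : (leaves G).Nonempty := card_pos.1 (by omega)
  obtain ⟨f, hfS, hfB, hmin⟩ := exists_rayleigh_minimizer hG hl
  set ν := dirichletForm G f f with hν
  have hort : ∀ g : V → ℝ, ∑ v ∈ leaves G, g v = 0 →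
      dirichletForm G f g = ν * leafForm G f g := by
    intro g hg
    refine sub_eq_zero.1 (eq_zero_of_forall_quadratic_nonneg
      (c := dirichletForm G g g - ν * leafForm G g g) fun t => ?_)
    have h := hmin (f + t • g) (by
      simp only [Pi.add_apply, Pi.smul_apply, smul_eq_mul, sum_add_distrib, ← mul_sum, hfS, hg]
      ring)
    rw [dirichletForm_add_smul_self, leafForm_add_smul_self, hfB, ← hν] at h
    linarith
  -- Subtracting from g its mean over the leaves changes neither side, because f has zero mean
  -- there.
  have hort' : ∀ g : V → ℝ, dirichletForm G f g = ν * leafForm G f g := by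
    intro g
    have hc : (#(leaves G) : ℝ) ≠ 0 := by exact_mod_cast (card_pos.2 hne).ne'
    set k := (∑ v ∈ leaves G, g v) / #(leaves G) with hk
    have h := hort (g + fun _ => -k) (by
      simp only [Pi.add_apply, sum_add_distrib, sum_const, nsmul_eq_mul, hk]
      field_simp
      ring)
    rwa [dirichletForm_add_right, leafForm_add_right, dirichletForm_const_right,
      leafForm_const_right, hfS, zero_mul, add_zero, add_zero] at h
  -- Testing with the indicator of v turns the weak equation into the pointwise one.
  have hlap : ∀ v, graphLaplacian G f v = if v ∈ leaves G then ν * f v else 0 := by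
    intro v
    have h := hort' (Pi.single v 1)
    rw [dirichletForm_eq_sum_laplacian, leafForm] at h
    simp only [Pi.single_apply, mul_ite, mul_one, mul_zero, sum_ite_eq', mem_univ, if_true] at h
    rw [h]
  have hf0 : f ≠ 0 := by
    rintro rfl
    simp [leafForm] at hfB
  have hνpos : 0 < ν := by
    refine lt_of_le_of_ne (dirichletForm_self_nonneg f) fun h0 => hf0 ?_
    obtain ⟨ω, hω⟩ := hne
    have hconst := eq_of_dirichletForm_eq_zero hG (f := f) h0.symm
    have h1 : ∑ v ∈ leaves G, f v = #(leaves G) * f ω := by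
      rw [sum_congr rfl fun v _ => hconst v ω, sum_const, nsmul_eq_mul]
    have hc : (#(leaves G) : ℝ) ≠ 0 := by exact_mod_cast (card_pos.2 ⟨ω, hω⟩).ne'
    have h2 := (mul_eq_zero.1 (h1.symm.trans hfS)).resolve_left hc
    ext v
    rw [hconst v ω, h2]; rfl
  have hev : IsSteklovEigenvalue G ν := by
    refine ⟨hνpos.le, f, hf0, fun v hv => ?_, fun ω ω' hω h => ?_⟩
    · rw [hlap, if_neg (mt mem_leaves.1 hv)]
    · rw [← graphLaplacian_leaf f hω h, hlap, if_pos (mem_leaves.2 hω)]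
  have hleast : IsLeast {lam : ℝ | 0 < lam ∧ IsSteklovEigenvalue G lam} ν := by
    refine ⟨⟨hνpos, hev⟩, ?_⟩
    rintro lam ⟨hlam, -, g, hg0, h1, h2⟩
    have hE := IsSteklovEigenvalue.form_eq h1 h2 g
    have hB := leafForm_pos_of_dirichletForm hG hne hg0 hE.le
    have := hmin g (IsSteklovEigenvalue.sum_leaves_eq_zero hlam.ne' h1 h2)
    rw [hE] at this
    exact le_of_mul_le_mul_right this hB
  have : steklovLambda2 G = ν := hleast.csInf_eq
  rw [this]
  exact ⟨hνpos, hev, hmin⟩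

end Variational

/-! ### Invariance under graph isomorphism. -/

section Iso

variable {V W : Type*} [Fintype V] [Fintype W] {G : SimpleGraph V} {H : SimpleGraph W}

omit [Fintype V] [Fintype W] in
theorem IsLeafVertex.of_iso (e : G ≃g H) {v : V} (h : IsLeafVertex G v) :
    IsLeafVertex H (e v) := by
  obtain ⟨w, hw, huniq⟩ := h
  refine ⟨e w, e.map_adj_iff.2 hw, fun y hy => ?_⟩
  have := huniq (e.symm y) (by
    have := e.symm.map_adj_iff.2 hy
    simpa using this)
  rw [← this]; simp

theorem graphLaplacian_iso (e : G ≃g H) (f : W → ℝ) (v : V) :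
    graphLaplacian G (f ∘ e) v = graphLaplacian H f (e v) := by
  classical
  rw [graphLaplacian_eq, graphLaplacian_eq, ← e.toEquiv.sum_comp]
  refine Finset.sum_congr rfl fun w _ => ?_
  change _ = if H.Adj (e v) (e w) then f (e v) - f (e w) else 0
  rw [e.map_adj_iff, Function.comp, Function.comp]

theorem IsSteklovEigenvalue.of_iso (e : G ≃g H) {lam : ℝ} (h : IsSteklovEigenvalue H lam) :
    IsSteklovEigenvalue G lam := by
  obtain ⟨h0, f, hf, h1, h2⟩ := h
  refine ⟨h0, f ∘ e, fun h => hf ?_, fun v hv => ?_, fun ω ω' hω h => ?_⟩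
  · ext w
    simpa using congrFun h (e.symm w)
  · rw [graphLaplacian_iso]
    refine h1 _ fun h => hv ?_
    simpa using h.of_iso e.symm
  · exact h2 _ _ (hω.of_iso e) (e.map_adj_iff.2 h)

theorem steklovLambda2_iso (e : G ≃g H) : steklovLambda2 G = steklovLambda2 H := by
  unfold steklovLambda2
  congr 1
  ext lam
  exact and_congr_right fun _ => ⟨fun h => h.of_iso e.symm, fun h => h.of_iso e⟩

omit [Fintype V] [Fintype W] in
theorem diam_le_of_iso (e : G ≃g H) : G.ediam ≤ H.ediam := by
  rw [SimpleGraph.ediam_le_iff]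
  intro u v
  refine le_trans ?_ (SimpleGraph.edist_le_ediam (u := e u) (v := e v))
  rcases eq_or_ne (H.edist (e u) (e v)) ⊤ with h | h
  · simp [h]
  obtain ⟨p, hp⟩ := SimpleGraph.exists_walk_of_edist_ne_top h
  have := SimpleGraph.edist_le (p.map e.symm.toHom)
  simpa [hp] using this

theorem IsTreeOfOrderDiam.of_iso (e : G ≃g H) {n D : ℕ} (h : IsTreeOfOrderDiam n D H) :
    IsTreeOfOrderDiam n D G := by
  obtain ⟨h1, h2, h3⟩ := h
  refine ⟨e.isTree_iff.2 h1, by rw [← h2]; exact Fintype.card_congr e.toEquiv, ?_⟩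
  rw [← h3, SimpleGraph.diam, SimpleGraph.diam,
    le_antisymm (diam_le_of_iso e) (diam_le_of_iso e.symm)]

end Iso

/-! ### Depth and height in rooted forests. -/

section Forest

variable {V : Type*}

/-- Roots are fixed by `par`, in agreement with truncated subtraction. -/
theorem depth_iterate {par : V → V} {d : V → ℕ} (hroot : ∀ v, d v = 0 → par v = v)
    (hpar : ∀ v, d v ≠ 0 → d (par v) + 1 = d v) (k : ℕ) (v : V) :
    d (par^[k] v) = d v - k := by
  induction k generalizing v with
  | zero => rfl
  | succ k ih =>
    rw [Function.iterate_succ_apply, ih]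
    rcases eq_or_ne (d v) 0 with h | h
    · rw [hroot v h]; omega
    · have := hpar v h; omega

open Classical in
/-- Heights in a finite rooted forest. -/
theorem exists_height [Fintype V] {par : V → V} {d : V → ℕ} (hroot : ∀ v, d v = 0 → par v = v)
    (hpar : ∀ v, d v ≠ 0 → d (par v) + 1 = d v) :
    ∃ H : V → ℕ, (∀ v, d v ≠ 0 → H v + 1 ≤ H (par v)) ∧
      (∀ u, 0 < H u → ∃ w, d w ≠ 0 ∧ par w = u ∧ H w + 1 = H u) ∧
      (∀ v k, k ≤ d v → k ≤ H (par^[k] v)) ∧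
      (∀ v, ∃ w, H v ≤ d w ∧ par^[H v] w = v) := by
  -- How far w lies below v; the value 0 for non-descendants does not affect the supremum.
  let F : V → V → ℕ := fun v w => if d v ≤ d w ∧ par^[d w - d v] w = v then d w - d v else 0
  let H : V → ℕ := fun v => Finset.univ.sup (F v)
  have h3 : ∀ v k, k ≤ d v → k ≤ H (par^[k] v) := by
    intro v k hk
    have h := Finset.le_sup (f := F (par^[k] v)) (Finset.mem_univ v)
    have hd := depth_iterate hroot hpar k v
    have h2 : d v - (d v - k) = k := by omega
    have : F (par^[k] v) v = k := by
      simp only [F, hd, h2, and_true]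
      rw [if_pos (by omega)]
    rw [this] at h
    exact h
  have h4 : ∀ v, ∃ w, H v ≤ d w ∧ par^[H v] w = v := by
    intro v
    obtain ⟨w, -, hw⟩ := Finset.exists_mem_eq_sup Finset.univ ⟨v, Finset.mem_univ v⟩ (F v)
    by_cases hc : d v ≤ d w ∧ par^[d w - d v] w = v
    · refine ⟨w, ?_⟩
      have : H v = d w - d v := by simp only [H, hw, F, if_pos hc]
      rw [this]
      exact ⟨by omega, hc.2⟩
    · refine ⟨v, ?_⟩
      have : H v = 0 := by simp only [H, hw, F, if_neg hc]
      simp [this]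
  have h1 : ∀ v, d v ≠ 0 → H v + 1 ≤ H (par v) := by
    intro v hv
    obtain ⟨w, hw1, hw2⟩ := h4 v
    have hd := depth_iterate hroot hpar (H v) w
    rw [hw2] at hd
    have := h3 w (H v + 1) (by omega)
    rwa [Function.iterate_succ_apply', hw2] at this
  refine ⟨H, h1, fun u hu => ?_, h3, h4⟩
  obtain ⟨w, hw1, hw2⟩ := h4 u
  obtain ⟨k, hk⟩ : ∃ k, H u = k + 1 := ⟨H u - 1, by omega⟩
  have hd := depth_iterate hroot hpar k w
  have h5 := h3 w k (by omega)
  rw [hk, Function.iterate_succ_apply'] at hw2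
  -- The highest child is the last vertex before u on the way up from a deepest descendant w.
  refine ⟨par^[k] w, by omega, hw2, ?_⟩
  have h6 := h1 (par^[k] w) (by omega)
  rw [hw2] at h6
  omega

end Forest

/-! ### Splitting a tree of odd diameter at its central edge. -/

section Bicentral

variable {V : Type*}

/-- The parent is the next vertex on a geodesic to c. Two candidates would give two paths to c, so
it is unique; since distances to c differ by one along an edge, every edge is a parent edge. -/
theorem SimpleGraph.IsTree.exists_parent {G : SimpleGraph V} (hG : G.IsTree) (c : V) :
    ∃ par : V → V, par c = c ∧ (∀ v, v ≠ c → G.Adj v (par v) ∧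
      G.dist c (par v) + 1 = G.dist c v) ∧ ∀ x y, G.Adj x y → par x = y ∨ par y = x := by
  classical
  have hconn := hG.connected
  have hex : ∀ v, v ≠ c → ∃ w, G.Adj v w ∧ G.dist c w + 1 = G.dist c v := by
    intro v hv
    obtain ⟨p, hp⟩ := hconn.exists_walk_length_eq_dist v c
    cases p with
    | nil => exact absurd rfl hv
    | @cons _ w _ h q =>
      refine ⟨w, h, ?_⟩
      rw [SimpleGraph.Walk.length_cons] at hp
      have h1 := SimpleGraph.dist_le q
      have h2 := hconn.dist_triangle (u := v) (v := w) (w := c)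
      have h3 := SimpleGraph.dist_eq_one_iff_adj.2 h
      rw [SimpleGraph.dist_comm (u := c), SimpleGraph.dist_comm (u := c)]
      omega
  have huniq : ∀ v w w', G.Adj v w → G.dist c w + 1 = G.dist c v → G.Adj v w' →
      G.dist c w' + 1 = G.dist c v → w = w' := by
    have key : ∀ v w, G.Adj v w → G.dist c w + 1 = G.dist c v →
        ∃ p : G.Walk v c, p.IsPath ∧ p.snd = w := by
      intro v w h hd
      obtain ⟨q, hq⟩ := hconn.exists_walk_length_eq_dist w c
      refine ⟨SimpleGraph.Walk.cons h q, SimpleGraph.Walk.isPath_of_length_eq_dist _ ?_, by simp⟩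
      rw [SimpleGraph.Walk.length_cons, hq, SimpleGraph.dist_comm, hd, SimpleGraph.dist_comm]
    intro v w w' h hd h' hd'
    obtain ⟨p, hp, hw⟩ := key v w h hd
    obtain ⟨p', hp', hw'⟩ := key v w' h' hd'
    rw [← hw, ← hw', (hG.existsUnique_path v c).unique hp hp']
  choose! par hadj hdist using hex
  refine ⟨fun v => if v = c then c else par v, if_pos rfl, fun v hv => ?_, fun x y hxy => ?_⟩
  · simp only [if_neg hv]
    exact ⟨hadj v hv, hdist v hv⟩
  · have pick : ∀ x y, G.Adj x y → G.dist c x = G.dist c y + 1 →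
        (if x = c then c else par x) = y := by
      intro x y hxy h
      have hx : x ≠ c := by
        rintro rfl
        simp at h
      rw [if_neg hx]
      exact huniq x _ _ (hadj x hx) (hdist x hx) hxy h.symm
    rcases hG.dist_eq_dist_add_one_of_adj c hxy with h | h
    · exact Or.inl (pick x y hxy h)
    · exact Or.inr (pick y x hxy.symm h)

/-- A tree presented as two rooted trees of height `r` whose roots `a` and `c` are joined by an
edge: `par` is the parent map (fixing the roots), `d` the depth, `H` the height, `ch` selects a
highest child, and `side` is the tree rooted at `a`. -/
structure BicentralForest (G : SimpleGraph V) (r : ℕ) where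
  (a c : V)
  (par ch : V → V)
  (d H : V → ℕ)
  (side : V → Prop)
  ne : a ≠ c
  adj_iff : ∀ x y, G.Adj x y ↔
    (x ≠ y ∧ (par x = y ∨ par y = x)) ∨ (x = a ∧ y = c) ∨ (x = c ∧ y = a)
  d_a : d a = 0
  d_c : d c = 0
  par_a : par a = a
  par_c : par c = c
  d_par : ∀ v, v ≠ a → v ≠ c → d (par v) + 1 = d v
  H_a : H a = r
  H_c : H c = r
  H_par : ∀ v, v ≠ a → v ≠ c → H v + 1 ≤ H (par v)
  ch_spec : ∀ u, 0 < H u → par (ch u) = u ∧ ch u ≠ a ∧ ch u ≠ c ∧ H (ch u) + 1 = H u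
  side_a : side a
  side_c : ¬ side c
  side_par : ∀ v, side (par v) ↔ side v

/-- Exchanging the two roots. -/
def BicentralForest.swap {G : SimpleGraph V} {r : ℕ} (B : BicentralForest G r) :
    BicentralForest G r where
  a := B.c
  c := B.a
  par := B.par
  ch := B.ch
  d := B.d
  H := B.H
  side v := ¬ B.side v
  ne := B.ne.symm
  adj_iff x y := by rw [B.adj_iff]; tauto
  d_a := B.d_c
  d_c := B.d_a
  par_a := B.par_c
  par_c := B.par_a
  d_par v h1 h2 := B.d_par v h2 h1
  H_a := B.H_c
  H_c := B.H_a
  H_par v h1 h2 := B.H_par v h2 h1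
  ch_spec u hu := by have := B.ch_spec u hu; tauto
  side_a := B.side_c
  side_c := by simpa using B.side_a
  side_par v := not_congr (B.side_par v)

/-- The middle edge of a geodesic; triangle inequalities upgrade the bounds from its two halves to
equalities. -/
theorem exists_central_edge {G : SimpleGraph V} (hG : G.Connected) {r : ℕ} {u v : V}
    (huv : G.dist u v = 2 * r + 1) :
    ∃ a c, G.Adj a c ∧ G.dist u a = r ∧ G.dist a v = r + 1 ∧ G.dist u c = r + 1 ∧
      G.dist c v = r := by
  obtain ⟨p, hp⟩ := hG.exists_walk_length_eq_dist u v
  have hadj := p.adj_getVert_succ (i := r) (by omega)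
  refine ⟨p.getVert r, p.getVert (r + 1), hadj, ?_⟩
  have h1 := SimpleGraph.dist_le (p.take r)
  have h2 := SimpleGraph.dist_le (p.drop (r + 1))
  rw [SimpleGraph.Walk.take_length] at h1
  rw [SimpleGraph.Walk.drop_length] at h2
  have h3 := SimpleGraph.dist_eq_one_iff_adj.2 hadj
  have t1 := hG.dist_triangle (u := u) (v := p.getVert r) (w := v)
  have t2 := hG.dist_triangle (u := u) (v := p.getVert (r + 1)) (w := v)
  have t3 := hG.dist_triangle (u := u) (v := p.getVert r) (w := p.getVert (r + 1))
  have t4 := hG.dist_triangle (u := p.getVert r) (v := p.getVert (r + 1)) (w := v)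
  omega

/-- Root the tree at c, let `side` be the subtree below a, and cut ac. The ends u and v of a
diameter lie on opposite sides at depth r, and the diameter allows no greater depth on either side.
-/
theorem exists_bicentralForest [Fintype V] {G : SimpleGraph V} (hG : G.IsTree) {r : ℕ}
    (hD : G.diam = 2 * r + 1) : Nonempty (BicentralForest G r) := by
  classical
  have hconn := hG.connected
  have : Nonempty V := hconn.nonempty
  obtain ⟨u, v, huv⟩ := G.exists_dist_eq_diam
  have hdiam : ∀ x y, G.dist x y ≤ 2 * r + 1 := fun x y =>
    hD ▸ SimpleGraph.dist_le_diam (SimpleGraph.connected_iff_ediam_ne_top.1 hconn)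
  rw [hD] at huv
  obtain ⟨a, c, hac, hua, hav, huc, hcv⟩ := exists_central_edge hconn huv
  obtain ⟨par₀, hpc, hpar₀, hadj₀⟩ := hG.exists_parent c
  have hdca : G.dist c a = 1 := SimpleGraph.dist_eq_one_iff_adj.2 hac.symm
  have hpa : par₀ a = c := (hadj₀ a c hac).resolve_right fun h => hac.ne (h.symm.trans hpc)
  have hd0 : ∀ x, G.dist c x = 0 → x = c := fun x hx => (hconn.dist_eq_zero_iff.1 hx).symm
  have hdiv : ∀ k x, G.dist c (par₀^[k] x) = G.dist c x - k := by
    refine depth_iterate (d := fun x => G.dist c x) (fun x hx => ?_) (fun x hx => ?_)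
    · rw [hd0 x hx, hpc]
    · exact (hpar₀ x (by rintro rfl; simp at hx)).2
  have hstep : ∀ k x, G.dist x (par₀^[k] x) ≤ k := by
    intro k
    induction k with
    | zero => simp
    | succ k ih =>
      intro x
      rw [Function.iterate_succ_apply]
      rcases eq_or_ne x c with rfl | hx
      · rw [hpc]; exact (ih x).trans (by omega)
      · have h1 := hconn.dist_triangle (u := x) (v := par₀ x) (w := par₀^[k] (par₀ x))
        have h2 := SimpleGraph.dist_eq_one_iff_adj.2 (hpar₀ x hx).1
        have h3 := ih (par₀ x)
        omega
  let side : V → Prop := fun x => ∃ k, par₀^[k] x = a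
  have side_a : side a := ⟨0, rfl⟩
  have side_c : ¬ side c := by
    rintro ⟨k, hk⟩
    rw [Function.iterate_fixed hpc] at hk
    exact hac.ne hk.symm
  have side_par₀ : ∀ x, x ≠ a → (side (par₀ x) ↔ side x) := by
    intro x hx
    constructor
    · rintro ⟨k, hk⟩
      exact ⟨k + 1, hk⟩
    · rintro ⟨k, hk⟩
      cases k with
      | zero => exact absurd hk hx
      | succ k => exact ⟨k, hk⟩
  have side_pos : ∀ x, side x → 1 ≤ G.dist c x := by
    intro x hx
    by_contra h
    exact side_c (hd0 x (by omega) ▸ hx)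
  -- The signed distance to c changes by at most 1 along edges, so vertices on opposite sides are at
  -- least as far apart as their distances to c add up to.
  let g : V → ℝ := fun x => if side x then (G.dist c x : ℝ) else -(G.dist c x : ℝ)
  have hg : ∀ x y, G.Adj x y → |g x - g y| ≤ 1 := by
    have key : ∀ x y, G.Adj x y → par₀ x = y → |g x - g y| ≤ 1 := by
      rintro x y hxy rfl
      have hxc : x ≠ c := by
        rintro rfl
        exact hxy.ne hpc.symm
      have hd := (hpar₀ x hxc).2
      have hd' : (G.dist c (par₀ x) : ℝ) + 1 = G.dist c x := by exact_mod_cast hd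
      rcases eq_or_ne x a with rfl | hxa
      · simp only [g, if_pos side_a, hpa, if_neg side_c, hdca]
        simp
      · simp only [g, side_par₀ x hxa]
        split_ifs
        · rw [← hd']; simp
        · rw [← hd', abs_le]; constructor <;> linarith
    intro x y hxy
    rcases hadj₀ x y hxy with h | h
    · exact key x y hxy h
    · rw [abs_sub_comm]; exact key y x hxy.symm h
  have hsep : ∀ x y, side x → ¬ side y → G.dist c x + G.dist c y ≤ G.dist x y := by
    intro x y hx hy
    have h := (le_abs_self _).trans (abs_sub_le_mul_dist hconn hg x y)
    simp only [g, if_pos hx, if_neg hy, sub_neg_eq_add, one_mul] at h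
    exact_mod_cast h
  have side_u : side u := by
    by_contra h
    have := hsep a u side_a h
    rw [SimpleGraph.dist_comm (u := a)] at this
    rw [SimpleGraph.dist_comm] at huc
    omega
  -- If v were below a, then a would be within r-1 of v, but their distance is r+1.
  have side_v : ¬ side v := by
    rintro ⟨k, hk⟩
    have h1 := hdiv k v
    have h2 := hstep k v
    rw [hk] at h1 h2
    rw [SimpleGraph.dist_comm] at h2
    omega
  have bound_a : ∀ x, side x → G.dist c x ≤ r + 1 := by
    intro x hx
    have h1 := hsep x v hx side_v
    have h2 := hdiam x v
    omega
  have bound_c : ∀ x, ¬ side x → G.dist c x ≤ r := by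
    intro x hx
    have h1 := hsep u x side_u hx
    have h2 := hdiam u x
    rw [SimpleGraph.dist_comm] at huc
    omega
  let par : V → V := fun x => if x = a then a else par₀ x
  -- On the side of a, depth is counted from a, which is one step from c.
  let d : V → ℕ := fun x => if side x then G.dist c x - 1 else G.dist c x
  have par_a : par a = a := if_pos rfl
  have par_c : par c = c := by simp only [par, if_neg hac.ne.symm, hpc]
  have par_eq : ∀ x, x ≠ a → par x = par₀ x := fun x hx => if_neg hx
  have side_par : ∀ x, side (par x) ↔ side x := by
    intro x
    rcases eq_or_ne x a with rfl | hx
    · rw [par_a]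
    · rw [par_eq x hx, side_par₀ x hx]
  have d_a : d a = 0 := by simp only [d, if_pos side_a, hdca]
  have d_c : d c = 0 := by simp only [d, if_neg side_c, SimpleGraph.dist_self]
  have d_par : ∀ x, x ≠ a → x ≠ c → d (par x) + 1 = d x := by
    intro x hxa hxc
    have h1 := (hpar₀ x hxc).2
    simp only [d, side_par]
    rw [par_eq x hxa]
    split_ifs with h
    · have := side_pos _ ((side_par₀ x hxa).2 h)
      omega
    · exact h1
  have d_zero : ∀ x, d x = 0 → x = a ∨ x = c := by
    intro x hx
    by_contra! h
    have := d_par x h.1 h.2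
    omega
  have d_root : ∀ x, d x = 0 → par x = x := by
    intro x hx
    rcases d_zero x hx with rfl | rfl
    · exact par_a
    · exact par_c
  have d_par' : ∀ x, d x ≠ 0 → d (par x) + 1 = d x := by
    intro x hx
    refine d_par x ?_ ?_
    · rintro rfl; exact hx d_a
    · rintro rfl; exact hx d_c
  have d_le : ∀ x, d x ≤ r := by
    intro x
    simp only [d]
    split_ifs with h
    · have := bound_a x h; omega
    · exact bound_c x h
  obtain ⟨H, hH1, hH2, hH3, hH4⟩ := exists_height d_root d_par'
  have side_iter : ∀ k x, side (par^[k] x) ↔ side x := by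
    intro k
    induction k with
    | zero => intro x; rfl
    | succ k ih => intro x; rw [Function.iterate_succ_apply, ih, side_par]
  have H_le : ∀ x, H x ≤ r := by
    intro x
    obtain ⟨w, hw, -⟩ := hH4 x
    exact hw.trans (d_le w)
  have d_u : d u = r := by
    simp only [d, if_pos side_u]
    rw [SimpleGraph.dist_comm] at huc
    omega
  have d_v : d v = r := by simp only [d, if_neg side_v, hcv]
  have root_u : par^[r] u = a := by
    refine (d_zero _ ?_).resolve_right fun h => side_c ?_
    · rw [depth_iterate d_root d_par', d_u, Nat.sub_self]
    · rw [← h, side_iter]; exact side_u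
  have root_v : par^[r] v = c := by
    refine (d_zero _ ?_).resolve_left fun h => side_v ?_
    · rw [depth_iterate d_root d_par', d_v, Nat.sub_self]
    · rw [← side_iter r, h]; exact side_a
  have hch : ∀ x, ∃ w, 0 < H x → par w = x ∧ w ≠ a ∧ w ≠ c ∧ H w + 1 = H x := by
    intro x
    rcases Nat.eq_zero_or_pos (H x) with h | h
    · exact ⟨x, fun h' => absurd h h'.ne'⟩
    · obtain ⟨w, h1, h2, h3⟩ := hH2 x h
      refine ⟨w, fun _ => ⟨h2, ?_, ?_, h3⟩⟩
      · rintro rfl; exact h1 d_a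
      · rintro rfl; exact h1 d_c
  choose ch hch using hch
  refine ⟨⟨a, c, par, ch, d, H, side, hac.ne, fun x y => ?_, d_a, d_c, par_a, par_c, d_par, ?_, ?_,
    fun x h1 h2 => hH1 x ?_, hch, side_a, side_c, side_par⟩⟩
  · have fwd : ∀ x y, x ≠ y → par x = y → G.Adj x y := by
      rintro x _ hxy rfl
      have hxa : x ≠ a := by
        rintro rfl
        exact hxy par_a.symm
      have hxc : x ≠ c := by
        rintro rfl
        exact hxy par_c.symm
      rw [par_eq x hxa]
      exact (hpar₀ x hxc).1
    have bwd : ∀ x y, par₀ x = y → par x = y ∨ (x = a ∧ y = c) := by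
      rintro x _ rfl
      rcases eq_or_ne x a with rfl | hx
      · exact Or.inr ⟨rfl, hpa⟩
      · exact Or.inl (par_eq x hx)
    constructor
    · intro h
      rcases hadj₀ x y h with h' | h'
      · rcases bwd x y h' with h'' | h''
        · exact Or.inl ⟨h.ne, Or.inl h''⟩
        · exact Or.inr (Or.inl h'')
      · rcases bwd y x h' with h'' | h''
        · exact Or.inl ⟨h.ne, Or.inr h''⟩
        · exact Or.inr (Or.inr h''.symm)
    · rintro (⟨h, h' | h'⟩ | ⟨rfl, rfl⟩ | ⟨rfl, rfl⟩)
      · exact fwd x y h h'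
      · exact (fwd y x h.symm h').symm
      · exact hac
      · exact hac.symm
  · refine le_antisymm (H_le a) ?_
    have := hH3 u r d_u.ge
    rwa [root_u] at this
  · refine le_antisymm (H_le c) ?_
    have := hH3 v r d_v.ge
    rwa [root_v] at this
  · have := d_par x h1 h2
    omega

end Bicentral

/-- The flux into the root of a path of length `l` which ends in a leaf, normalised to have the
value `1` at the root and satisfying the Steklov condition for `lam` at the leaf, is
`response lam l`. -/
noncomputable def response (lam : ℝ) (l : ℕ) : ℝ := lam / (1 - lam * l)

/-! ### Path decomposition, test function and upper bound for `λ₂`. -/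

namespace BicentralForest

open Finset Classical

variable {V : Type*} {G : SimpleGraph V} {r : ℕ} (B : BicentralForest G r)

include B

theorem par_ne {v : V} (ha : v ≠ B.a) (hc : v ≠ B.c) : B.par v ≠ v := by
  intro h
  have := B.d_par v ha hc
  rw [h] at this
  omega

theorem par_par_ne {v : V} (ha : v ≠ B.a) (hc : v ≠ B.c) : B.par (B.par v) ≠ v := by
  intro h
  have h1 := B.d_par v ha hc
  by_cases hpa : B.par v = B.a
  · rw [hpa, B.par_a] at h; exact ha h.symm
  by_cases hpc : B.par v = B.c
  · rw [hpc, B.par_c] at h; exact hc h.symm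
  have h2 := B.d_par _ hpa hpc
  rw [h] at h2
  omega

theorem adj_par {v : V} (ha : v ≠ B.a) (hc : v ≠ B.c) : G.Adj v (B.par v) :=
  (B.adj_iff _ _).2 (Or.inl ⟨(B.par_ne ha hc).symm, Or.inl rfl⟩)

theorem adj_roots : G.Adj B.a B.c := (B.adj_iff _ _).2 (Or.inr (Or.inl ⟨rfl, rfl⟩))

theorem adj_ch {v : V} (hv : 0 < B.H v) : G.Adj v (B.ch v) := by
  obtain ⟨h1, h2, h3, -⟩ := B.ch_spec v hv
  have := B.adj_par h2 h3
  rw [h1] at this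
  exact this.symm

/-- A vertex of positive height has a child and, in addition, its parent or the opposite root as
neighbour. -/
theorem isLeafVertex_iff (hr : 1 ≤ r) (v : V) : IsLeafVertex G v ↔ B.H v = 0 := by
  constructor
  · intro hv
    by_contra hH
    have hH : 0 < B.H v := Nat.pos_of_ne_zero hH
    obtain ⟨h1, h2, h3, -⟩ := B.ch_spec v hH
    have hadj := B.adj_ch hH
    by_cases ha : v = B.a
    · exact h3 (hv.unique hadj (ha ▸ B.adj_roots))
    by_cases hc : v = B.c
    · exact h2 (hv.unique hadj (hc ▸ B.adj_roots.symm))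
    have := hv.unique hadj (B.adj_par ha hc)
    have h4 := B.par_par_ne ha hc
    rw [← this, h1] at h4
    exact h4 rfl
  · intro hH
    have ha : v ≠ B.a := by
      rintro rfl
      rw [B.H_a] at hH; omega
    have hc : v ≠ B.c := by
      rintro rfl
      rw [B.H_c] at hH; omega
    refine ⟨B.par v, B.adj_par ha hc, fun w hw => ?_⟩
    rcases (B.adj_iff v w).1 hw with ⟨hvw, h | h⟩ | ⟨h, -⟩ | ⟨h, -⟩
    · exact h.symm
    · by_cases hwa : w = B.a
      · rw [hwa, B.par_a] at h; exact absurd h.symm ha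
      by_cases hwc : w = B.c
      · rw [hwc, B.par_c] at h; exact absurd h.symm hc
      have := B.H_par w hwa hwc
      rw [h] at this
      omega
    · exact absurd h ha
    · exact absurd h hc

theorem exists_H_eq_zero (v : V) : ∃ w, B.H w = 0 ∧ (B.side w ↔ B.side v) := by
  induction hk : B.H v generalizing v with
  | zero => exact ⟨v, hk, Iff.rfl⟩
  | succ k ih =>
    obtain ⟨h1, -, -, h4⟩ := B.ch_spec v (by omega)
    obtain ⟨w, hw, hs⟩ := ih (B.ch v) (by omega)
    refine ⟨w, hw, hs.trans ?_⟩
    rw [← B.side_par, h1]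

theorem H_add_one_le {v : V} (ha : v ≠ B.a) (hc : v ≠ B.c) : B.H v + 1 ≤ r := by
  induction hk : B.d v generalizing v with
  | zero => have := B.d_par v ha hc; omega
  | succ k ih =>
    have h := B.H_par v ha hc
    by_cases hpa : B.par v = B.a
    · rwa [hpa, B.H_a] at h
    by_cases hpc : B.par v = B.c
    · rwa [hpc, B.H_c] at h
    have h2 := B.d_par v ha hc
    have := ih hpa hpc (by omega)
    omega

variable [Fintype V]

/-- The top vertices of the paths, other than those through the roots, in the decomposition of the
forest into descending paths of selected children. -/
noncomputable def tops : Finset V :=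
  univ.filter fun v => v ≠ B.a ∧ v ≠ B.c ∧ B.ch (B.par v) ≠ v

/-- Every vertex is a root, a path top, or the selected child of exactly one vertex of positive
height. All telescoping along the paths goes through this identity. -/
theorem sum_eq_sum_tops {M : Type*} [AddCommMonoid M] (φ : V → M) :
    ∑ v, φ v = φ B.a + φ B.c + ∑ v ∈ B.tops, φ v +
      ∑ u ∈ univ.filter (fun u => 0 < B.H u), φ (B.ch u) := by
  have h1 : ∑ u ∈ univ.filter (fun u => 0 < B.H u), φ (B.ch u) =
      ∑ v ∈ univ.filter (fun v => v ≠ B.a ∧ v ≠ B.c ∧ B.ch (B.par v) = v), φ v := by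
    refine sum_nbij' B.ch B.par ?_ ?_ ?_ ?_ ?_
    · intro u hu
      obtain ⟨h1, h2, h3, h4⟩ := B.ch_spec u (by simpa using hu)
      simp [h1, h2, h3]
    · intro v hv
      simp only [mem_filter, mem_univ, true_and] at hv ⊢
      have := B.H_par v hv.1 hv.2.1
      omega
    · intro u hu
      exact (B.ch_spec u (by simpa using hu)).1
    · intro v hv
      simp only [mem_filter, mem_univ, true_and] at hv
      exact hv.2.2
    · intro u _; rfl
  have h2 : ∑ v ∈ univ.filter (fun v => v ≠ B.a ∧ v ≠ B.c), φ v = ∑ v ∈ B.tops, φ v +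
      ∑ v ∈ univ.filter (fun v => v ≠ B.a ∧ v ≠ B.c ∧ B.ch (B.par v) = v), φ v := by
    rw [← sum_filter_not_add_sum_filter _ (fun v => B.ch (B.par v) = v), filter_filter,
      filter_filter, tops]
    simp only [and_assoc, ne_eq]
  have h3 : univ.filter (fun v => ¬ (v ≠ B.a ∧ v ≠ B.c)) = {B.a, B.c} := by
    ext v
    simp
    tauto
  rw [← sum_filter_not_add_sum_filter univ (fun v => v ≠ B.a ∧ v ≠ B.c), h3, h2, h1,
    sum_pair B.ne]
  simp only [add_assoc]

/-- Sum H + 1: a selected child of u contributes H u, so these terms cancel the sum of all heights.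
-/
theorem card_eq : Fintype.card V = 2 * r + 2 + ∑ v ∈ B.tops, (B.H v + 1) := by
  have h := B.sum_eq_sum_tops fun v => B.H v + 1
  have h1 : ∑ u ∈ univ.filter (fun u => 0 < B.H u), (B.H (B.ch u) + 1) = ∑ u, B.H u := by
    rw [sum_filter]
    refine sum_congr rfl fun u _ => ?_
    split_ifs with hu
    · exact (B.ch_spec u hu).2.2.2
    · omega
  rw [h1, B.H_a, B.H_c, sum_add_distrib, sum_const, card_univ] at h
  simp only [smul_eq_mul, mul_one] at h
  omega

/-- Each edge other than ac occurs once, at its lower end; the roots contribute 0 because `par`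
fixes them. -/
theorem dirichletForm_self_eq (f : V → ℝ) :
    dirichletForm G f f = (f B.a - f B.c) ^ 2 + ∑ v, (f v - f (B.par v)) ^ 2 := by
  set F : V → V → ℝ := fun x y => (f x - f y) * (f x - f y) with hF
  have hsymm : ∀ x y, F x y = F y x := fun x y => by simp only [hF]; ring
  have key : ∀ x y, (if G.Adj x y then F x y else 0) =
      ((if y = B.par x then F x y else 0) + (if x = B.par y then F x y else 0)) +
      ((if x = B.a then (if y = B.c then F x y else 0) else 0) +
        (if x = B.c then (if y = B.a then F x y else 0) else 0)) := by
    intro x y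
    rcases eq_or_ne x y with rfl | hxy
    · simp [hF]
    have hac := B.ne
    have hca := B.ne.symm
    by_cases h1 : y = B.par x
    · have hxa : x ≠ B.a := by rintro rfl; exact hxy (h1.trans B.par_a).symm
      have hxc : x ≠ B.c := by rintro rfl; exact hxy (h1.trans B.par_c).symm
      have h2 : x ≠ B.par y := by rw [h1]; exact (B.par_par_ne hxa hxc).symm
      have h3 : G.Adj x y := h1 ▸ B.adj_par hxa hxc
      simp only [if_pos h3, if_pos h1, if_neg h2, if_neg hxa, if_neg hxc, add_zero]
    · by_cases h2 : x = B.par y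
      · have hya : y ≠ B.a := by rintro rfl; exact hxy (h2.trans B.par_a)
        have hyc : y ≠ B.c := by rintro rfl; exact hxy (h2.trans B.par_c)
        have h3 : G.Adj x y := h2 ▸ (B.adj_par hya hyc).symm
        simp only [if_pos h3, if_neg h1, if_pos h2, if_neg hya, if_neg hyc, add_zero, zero_add,
          ite_self]
      · have h3 := B.adj_iff x y
        rw [eq_comm (a := B.par x), eq_comm (a := B.par y)] at h3
        simp only [h1, h2, or_self, and_false, false_or] at h3
        simp only [h3, if_neg h1, if_neg h2, zero_add]
        by_cases hxa : x = B.a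
        · have hxc : x ≠ B.c := hxa ▸ hac
          by_cases hyc : y = B.c <;> simp [hxa, hyc, hac, hca]
        · by_cases hxc : x = B.c
          · by_cases hya : y = B.a <;> simp [hya, hxc, hac, hca]
          · simp [hxa, hxc]
  change (1 / 2) * (∑ x, ∑ y, if G.Adj x y then F x y else 0) = _
  have h1 : ∑ x, ∑ y, (if G.Adj x y then F x y else 0) =
      2 * (∑ x, F x (B.par x)) + 2 * F B.a B.c := by
    simp_rw [key, sum_add_distrib]
    rw [sum_comm (f := fun x y => if x = B.par y then F x y else 0)]
    simp only [sum_ite_eq', mem_univ, if_true]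
    have e1 : ∑ x, ∑ y, (if x = B.a then (if y = B.c then F x y else 0) else 0) = F B.a B.c := by
      rw [sum_eq_single B.a]
      · simp
      · intro b _ hb; simp [hb]
      · simp
    have e2 : ∑ x, ∑ y, (if x = B.c then (if y = B.a then F x y else 0) else 0) = F B.c B.a := by
      rw [sum_eq_single B.c]
      · simp
      · intro b _ hb; simp [hb]
      · simp
    rw [e1, e2, hsymm B.c, sum_congr rfl fun x _ => hsymm (B.par x) x]
    ring
  rw [h1]
  simp only [hF]
  rw [mul_add, ← mul_assoc, ← mul_assoc]
  norm_num
  rw [add_comm]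
  simp_rw [sq]

section TestFunction

variable {lam : ℝ}

omit B [Fintype V] in
theorem response_pos {h : ℕ} (h0 : 0 < lam) (hlam : lam * r < 1) (hh : h ≤ r) :
    0 < response lam h := by
  have : (h : ℝ) ≤ r := by exact_mod_cast hh
  refine div_pos h0 ?_
  nlinarith

-- The recursion gives v the value it would have if a single path with H v + 1 edges, affine and
-- with the Steklov condition at its leaf, hung from its parent. All ratios exceed 1, so F increases
-- strictly downwards; it is their product along the way to the root.
omit [Fintype V] in
theorem exists_testFunction (h0 : 0 < lam) (hlam : lam * r < 1) :
    ∃ F : V → ℝ, F B.a = 1 ∧ F B.c = 1 ∧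
      (∀ v, v ≠ B.a → v ≠ B.c → F v * (1 - lam * (B.H v + 1 : ℕ)) =
        F (B.par v) * (1 - lam * B.H v)) ∧
      (∀ v, 1 ≤ F v) ∧ ∀ v, v ≠ B.a → v ≠ B.c → 1 < F v := by
  let ρ : V → ℝ := fun v => (1 - lam * B.H v) / (1 - lam * (B.H v + 1 : ℕ))
  let F : V → ℝ := fun v => ∏ i ∈ range (B.d v), ρ (B.par^[i] v)
  have hF : ∀ v, v ≠ B.a → v ≠ B.c → F v = F (B.par v) * ρ v := by
    intro v ha hc
    simp only [F, ← B.d_par v ha hc, prod_range_succ', Function.iterate_succ_apply,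
      Function.iterate_zero, id]
  have hFa : F B.a = 1 := by simp [F, B.d_a]
  have hFc : F B.c = 1 := by simp [F, B.d_c]
  have hpos : ∀ v, v ≠ B.a → v ≠ B.c → 0 < 1 - lam * (B.H v + 1 : ℕ) := by
    intro v ha hc
    have : ((B.H v + 1 : ℕ) : ℝ) ≤ r := by exact_mod_cast B.H_add_one_le ha hc
    nlinarith
  have hρ : ∀ v, v ≠ B.a → v ≠ B.c → 1 < ρ v := by
    intro v ha hc
    have := hpos v ha hc
    rw [one_lt_div this]
    push_cast
    linarith
  have hone : ∀ v, 1 ≤ F v := by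
    intro v
    induction hk : B.d v generalizing v with
    | zero => simp [F, hk]
    | succ k ih =>
      have ha : v ≠ B.a := by rintro rfl; rw [B.d_a] at hk; omega
      have hc : v ≠ B.c := by rintro rfl; rw [B.d_c] at hk; omega
      have h1 := ih (B.par v) (by have := B.d_par v ha hc; omega)
      rw [hF v ha hc]
      exact one_le_mul_of_one_le_of_one_le h1 (hρ v ha hc).le
  refine ⟨F, hFa, hFc, fun v ha hc => ?_, hone, fun v ha hc => ?_⟩
  · rw [hF v ha hc, mul_assoc, div_mul_cancel₀ _ (hpos v ha hc).ne']
  · rw [hF v ha hc]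
    exact one_lt_mul_of_le_of_lt (hone _) (hρ v ha hc)

/-- The recursion makes (f v - f (par v))² equal to R(H v) f(v)² - R(H v + 1) f(par v)², where R is
`response lam`. As H (ch u) + 1 = H u, this telescopes along selected paths; at the leaves R(0) =
lam cancels the leaf norm, and only roots and tops remain. -/
theorem energy_testFunction (hr : 1 ≤ r) (h0 : 0 < lam) (hlam : lam * r < 1) {f : V → ℝ}
    (hf : ∀ v, v ≠ B.a → v ≠ B.c → f v * (1 - lam * (B.H v + 1 : ℕ)) =
        f (B.par v) * (1 - lam * B.H v)) :
    dirichletForm G f f - lam * leafForm G f f = (f B.a - f B.c) ^ 2 -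
      response lam r * (f B.a ^ 2 + f B.c ^ 2) -
      ∑ v ∈ B.tops, response lam (B.H v + 1) * f (B.par v) ^ 2 := by
  -- At the roots ψ is set so that the edge identity below reads 0 = 0.
  let ψ : V → ℝ := fun v => if v = B.a ∨ v = B.c then response lam r * f v ^ 2 else
    response lam (B.H v + 1) * f (B.par v) ^ 2
  have h1 : ∀ v, (f v - f (B.par v)) ^ 2 = response lam (B.H v) * f v ^ 2 - ψ v := by
    intro v
    by_cases ha : v = B.a
    · simp [ψ, ha, B.par_a, B.H_a]
    by_cases hc : v = B.c
    · simp [ψ, hc, B.par_c, B.H_c]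
    have h2 : ((B.H v + 1 : ℕ) : ℝ) ≤ r := by exact_mod_cast B.H_add_one_le ha hc
    have h3 : 0 < 1 - lam * (B.H v + 1 : ℕ) := by nlinarith
    have h4 : 0 < 1 - lam * B.H v := by push_cast at h3; linarith
    have h5 : f v = f (B.par v) * (1 - lam * B.H v) / (1 - lam * (B.H v + 1 : ℕ)) := by
      rw [eq_div_iff h3.ne', hf v ha hc]
    simp only [ψ, ha, hc, or_self, if_false, response]
    rw [h5]
    field_simp
    push_cast
    ring
  have h2 : ∑ v, ψ v = response lam r * f B.a ^ 2 + response lam r * f B.c ^ 2 +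
      ∑ v ∈ B.tops, response lam (B.H v + 1) * f (B.par v) ^ 2 +
      ∑ u ∈ univ.filter (fun u => 0 < B.H u), response lam (B.H u) * f u ^ 2 := by
    rw [B.sum_eq_sum_tops]
    congr 1
    · congr 1
      · simp [ψ]
      · refine sum_congr rfl fun v hv => ?_
        simp only [tops, mem_filter, mem_univ, true_and] at hv
        simp [ψ, hv.1, hv.2.1]
    · refine sum_congr rfl fun u hu => ?_
      obtain ⟨e1, e2, e3, e4⟩ := B.ch_spec u (by simpa using hu)
      simp [ψ, e1, e2, e3, e4]
  have h3 : lam * leafForm G f f =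
      ∑ u ∈ univ.filter (fun u => ¬ 0 < B.H u), response lam (B.H u) * f u ^ 2 := by
    rw [leafForm, leaves, mul_sum]
    have : univ.filter (IsLeafVertex G) = univ.filter (fun u => ¬ 0 < B.H u) := by
      ext v
      simp [B.isLeafVertex_iff hr]
    rw [this]
    refine sum_congr rfl fun u hu => ?_
    have : B.H u = 0 := by simpa using hu
    simp [this, response, sq]
  rw [B.dirichletForm_self_eq, sum_congr rfl fun v _ => h1 v, sum_sub_distrib, h2, h3,
    ← sum_filter_add_sum_filter_not univ (fun u => 0 < B.H u)
      (fun u => response lam (B.H u) * f u ^ 2)]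
  ring

theorem two_le_card_leaves (hr : 1 ≤ r) : 2 ≤ #(leaves G) := by
  obtain ⟨u, hu, hus⟩ := B.exists_H_eq_zero B.a
  obtain ⟨w, hw, hws⟩ := B.exists_H_eq_zero B.c
  refine one_lt_card.2 ⟨u, mem_leaves.2 ((B.isLeafVertex_iff hr u).2 hu), w,
    mem_leaves.2 ((B.isLeafVertex_iff hr w).2 hw), ?_⟩
  rintro rfl
  exact B.side_c (hws.1 (hus.2 B.side_a))

-- Multiplying by q + α completes a square: the result is 1 - (q+α)(q+β) - ((q+α)x+1)², and
-- (q+α)(q+β) exceeds q(q+α+β) by αβ. In equality αβ = 0, which will mean that one side carries no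
-- path tops.
omit B [Fintype V] in
theorem quadratic_nonpos_of_one_le {q α β : ℝ} (hq : 0 < q) (hα : 0 ≤ α) (hβ : 0 ≤ β)
    (h : 1 ≤ q * (q + (α + β))) (x : ℝ) :
    (x - 1) ^ 2 - (q + 1) * (x ^ 2 + 1) - (α * x ^ 2 + β) ≤ 0 ∧
      ((x - 1) ^ 2 - (q + 1) * (x ^ 2 + 1) - (α * x ^ 2 + β) = 0 →
        q * (q + (α + β)) = 1 ∧ α * β = 0) := by
  have hpos : 0 < q + α := by linarith
  have hprod : q * (q + (α + β)) + α * β = (q + α) * (q + β) := by ring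
  have hαβ : 0 ≤ α * β := mul_nonneg hα hβ
  have hsq := sq_nonneg ((q + α) * x + 1)
  have key : (q + α) * ((x - 1) ^ 2 - (q + 1) * (x ^ 2 + 1) - (α * x ^ 2 + β)) =
      1 - (q + α) * (q + β) - ((q + α) * x + 1) ^ 2 := by ring
  refine ⟨?_, fun h0 => ?_⟩
  · by_contra! h0
    have := mul_pos hpos h0
    linarith
  · rw [h0, mul_zero] at key
    constructor <;> linarith

/-- The basic upper bound for `λ₂`, with its case of equality. -/
theorem steklovLambda2_le (hG : G.Connected) (hr : 1 ≤ r) (hlam : lam * r < 1)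
    (hlam' : 1 < lam * (r + 1))
    (hΦ : 1 ≤ (response lam r - 1) *
      (response lam r - 1 + ∑ v ∈ B.tops, response lam (B.H v + 1))) :
    steklovLambda2 G ≤ lam ∧ (steklovLambda2 G = lam →
      ((∀ v ∈ B.tops, B.par v = B.a) ∨ ∀ v ∈ B.tops, B.par v = B.c) ∧
      (response lam r - 1) *
        (response lam r - 1 + ∑ v ∈ B.tops, response lam (B.H v + 1)) = 1) := by
  have h0 : 0 < lam := by
    by_contra h
    have : (0 : ℝ) ≤ r + 1 := by positivity
    nlinarith
  obtain ⟨F, hFa, hFc, hF, hF1, hF2⟩ := B.exists_testFunction h0 hlam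
  have hleaf := B.two_le_card_leaves hr
  obtain ⟨hpos, -, hmin⟩ := steklovLambda2_spec hG hleaf
  have hS : ∀ v, 0 < ∑ w ∈ (leaves G).filter (fun w => B.side w ↔ B.side v), F w := by
    intro v
    obtain ⟨w, hw, hws⟩ := B.exists_H_eq_zero v
    refine sum_pos' (fun w _ => zero_le_one.trans (hF1 w)) ⟨w, ?_, zero_lt_one.trans_le (hF1 w)⟩
    exact mem_filter.2 ⟨mem_leaves.2 ((B.isLeafVertex_iff hr w).2 hw), hws⟩
  have hSa := hS B.a
  have hSc := hS B.c
  simp only [B.side_a, iff_true] at hSa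
  simp only [B.side_c, iff_false] at hSc
  set Sa := ∑ w ∈ (leaves G).filter (fun w => B.side w), F w
  set Sc := ∑ w ∈ (leaves G).filter (fun w => ¬ B.side w), F w
  -- The unique ratio of the root values for which the test function has leaf sum zero.
  set x : ℝ := -(Sc / Sa) with hx
  have hx0 : x < 0 := neg_lt_zero.2 (div_pos hSc hSa)
  let f : V → ℝ := fun v => if B.side v then x * F v else F v
  have hfa : f B.a = x := by simp [f, B.side_a, hFa]
  have hfc : f B.c = 1 := by simp [f, B.side_c, hFc]
  have hf : ∀ v, v ≠ B.a → v ≠ B.c → f v * (1 - lam * (B.H v + 1 : ℕ)) =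
        f (B.par v) * (1 - lam * B.H v) := by
    intro v ha hc
    simp only [f, B.side_par]
    split_ifs
    · rw [mul_assoc, hF v ha hc, mul_assoc]
    · exact hF v ha hc
  have hfS : ∑ v ∈ leaves G, f v = 0 := by
    simp only [f]
    rw [sum_ite, ← mul_sum]
    change x * Sa + Sc = 0
    rw [hx]
    field_simp
    ring
  have hE := B.energy_testFunction hr h0 hlam hf
  rw [hfa, hfc, one_pow] at hE
  set p := response lam r
  have hp : 1 < p := by
    have : 0 < 1 - lam * r := by linarith
    simp only [p, response]
    rw [one_lt_div this]
    linarith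
  set g : V → ℝ := fun v => response lam (B.H v + 1) with hg
  have htop : ∀ v ∈ B.tops, v ≠ B.a ∧ v ≠ B.c := fun v hv => by
    simp only [tops, mem_filter, mem_univ, true_and] at hv
    exact ⟨hv.1, hv.2.1⟩
  have hgpos : ∀ v ∈ B.tops, 0 < g v := fun v hv =>
    response_pos h0 hlam (B.H_add_one_le (htop v hv).1 (htop v hv).2)
  let y : V → ℝ := fun v => if B.side v then x ^ 2 else 1
  -- Moving a path up to the root of its side can only weaken the estimate, since F ≥ 1.
  have hterm : ∀ v ∈ B.tops, g v * y v ≤ g v * f (B.par v) ^ 2 := by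
    intro v hv
    refine mul_le_mul_of_nonneg_left ?_ (hgpos v hv).le
    simp only [f, y, B.side_par]
    have h1 : 1 ≤ F (B.par v) ^ 2 := one_le_pow₀ (hF1 (B.par v))
    split_ifs
    · rw [mul_pow]
      exact le_mul_of_one_le_right (sq_nonneg x) h1
    · exact h1
  set Ga := ∑ v ∈ B.tops.filter (fun v => B.side v), g v with hGa
  set Gc := ∑ v ∈ B.tops.filter (fun v => ¬ B.side v), g v with hGc
  have hGsum : ∑ v ∈ B.tops, g v = Ga + Gc := (sum_filter_add_sum_filter_not _ _ _).symm
  have hGy : ∑ v ∈ B.tops, g v * y v = Ga * x ^ 2 + Gc := by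
    simp only [y, mul_ite, mul_one]
    rw [sum_ite, hGa, sum_mul]
  have hGa0 : 0 ≤ Ga := sum_nonneg fun v hv => (hgpos v (mem_filter.1 hv).1).le
  have hGc0 : 0 ≤ Gc := sum_nonneg fun v hv => (hgpos v (mem_filter.1 hv).1).le
  rw [hGsum] at hΦ ⊢
  have hle := sum_le_sum hterm
  rw [hGy] at hle
  set q := p - 1 with hq
  have hq0 : 0 < q := by rw [hq]; linarith
  obtain ⟨hquad0, hquad⟩ := quadratic_nonpos_of_one_le hq0 hGa0 hGc0 hΦ x
  rw [hq, sub_add_cancel] at hquad0 hquad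
  rw [← hq] at hquad
  have hf0 : f ≠ 0 := fun h => by
    rw [h] at hfc
    simp at hfc
  have hB := leafForm_pos_of_dirichletForm (lam := lam) hG (card_pos.1 (by omega)) hf0
    (by linarith)
  have hmin' := hmin f hfS
  refine ⟨le_of_mul_le_mul_right (hmin'.trans (by linarith)) hB, fun heq => ?_⟩
  rw [heq] at hmin'
  have hquad1 : (x - 1) ^ 2 - p * (x ^ 2 + 1) - (Ga * x ^ 2 + Gc) = 0 := by linarith
  have hsum : ∑ v ∈ B.tops, g v * y v = ∑ v ∈ B.tops, g v * f (B.par v) ^ 2 := by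
    rw [hGy]
    linarith
  obtain ⟨hΦ1, hGG0⟩ := hquad hquad1
  refine ⟨?_, hΦ1⟩
  -- Equality forces F (par v) = 1, and F > 1 away from the roots.
  have hroot : ∀ v ∈ B.tops, B.par v = B.a ∨ B.par v = B.c := by
    intro v hv
    by_contra! h
    have h1 := (sum_eq_sum_iff_of_le hterm).1 hsum v hv
    have h2 := mul_left_cancel₀ (hgpos v hv).ne' h1
    have h3 : 1 < F (B.par v) ^ 2 := one_lt_pow₀ (hF2 _ h.1 h.2) two_ne_zero
    simp only [f, y, B.side_par] at h2
    split_ifs at h2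
    · rw [mul_pow] at h2
      exact (lt_mul_of_one_lt_right (sq_pos_of_neg hx0) h3).ne h2
    · exact h3.ne h2
  have hempty : ∀ (P : V → Prop) [DecidablePred P], ∑ v ∈ B.tops.filter P, g v = 0 → ∀ v ∈ B.tops, ¬ P v := by
    intro P _ h v hv hP
    have hmem : v ∈ B.tops.filter P := mem_filter.2 ⟨hv, hP⟩
    have := (sum_eq_zero_iff_of_nonneg fun v hv => (hgpos v (mem_filter.1 hv).1).le).1 h v hmem
    exact (hgpos v hv).ne' this
  rcases mul_eq_zero.1 hGG0 with h | h
  · refine Or.inr fun v hv => (hroot v hv).resolve_left fun h' => hempty B.side h v hv ?_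
    rw [← B.side_par, h']
    exact B.side_a
  · refine Or.inl fun v hv => (hroot v hv).resolve_right fun h' =>
      hempty (fun v => ¬ B.side v) h v hv ?_
    simp only [← B.side_par v, h']
    exact B.side_c

end TestFunction

end BicentralForest

/-! ### Spiders: adjacency, order and diameter. -/

section Spider

variable {l : List ℕ}

/-- The vertex at distance `k` from the center on the `i`-th branch of a spider. -/
def spiderNode (l : List ℕ) (i : Fin l.length) :
    (k : ℕ) → k ≤ l.get i → Option (Σ i : Fin l.length, Fin (l.get i))
  | 0, _ => none
  | k + 1, h => some ⟨i, ⟨k, h⟩⟩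

theorem eq_none_or_spiderNode (x : Option (Σ i : Fin l.length, Fin (l.get i))) :
    x = none ∨ ∃ i k h, x = spiderNode l i (k + 1) h := by
  rcases x with _ | ⟨i, k, hk⟩
  · exact Or.inl rfl
  · exact Or.inr ⟨i, k, hk, rfl⟩

theorem spider_adj_none_some {i : Fin l.length} {j : Fin (l.get i)} :
    (spider l).Adj none (some ⟨i, j⟩) ↔ (j : ℕ) = 0 := by
  simp [spider, SimpleGraph.fromRel_adj]

theorem spider_adj_some_some {i i' : Fin l.length} {j : Fin (l.get i)} {j' : Fin (l.get i')} :
    (spider l).Adj (some ⟨i, j⟩) (some ⟨i', j'⟩) ↔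
      i = i' ∧ ((j : ℕ) + 1 = j' ∨ (j' : ℕ) + 1 = j) := by
  simp only [spider, SimpleGraph.fromRel_adj]
  constructor
  · rintro ⟨-, ⟨h1, h2⟩ | ⟨h1, h2⟩⟩
    · exact ⟨h1, Or.inl h2⟩
    · exact ⟨h1.symm, Or.inr h2⟩
  · rintro ⟨rfl, h⟩
    refine ⟨fun h' => ?_, h.imp (fun h => ⟨rfl, h⟩) fun h => ⟨rfl, h⟩⟩
    obtain rfl : j = j' := by simpa using h'
    omega

theorem spider_adj_node_succ {i : Fin l.length} {k : ℕ} (h : k + 1 ≤ l.get i)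
    (y : Option (Σ i : Fin l.length, Fin (l.get i))) :
    (spider l).Adj (spiderNode l i (k + 1) h) y ↔
      y = spiderNode l i k (Nat.le_of_succ_le h) ∨ ∃ h', y = spiderNode l i (k + 2) h' := by
  rcases y with _ | ⟨i', j', hj'⟩
  · rw [SimpleGraph.adj_comm, spiderNode, spider_adj_none_some]
    cases k <;> simp [spiderNode]
  · rw [spiderNode, spider_adj_some_some]
    constructor
    · rintro ⟨rfl, h1 | h1⟩
      · simp only at h1
        subst h1
        exact Or.inr ⟨hj', rfl⟩
      · simp only at h1
        subst h1
        exact Or.inl rfl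
    · rintro (h1 | ⟨h', h1⟩)
      · cases k with
        | zero => simp [spiderNode] at h1
        | succ k =>
          simp only [spiderNode, Option.some.injEq, Sigma.mk.injEq] at h1
          obtain ⟨rfl, h2⟩ := h1
          simp only [heq_eq_eq, Fin.mk.injEq] at h2
          exact ⟨rfl, Or.inr (by simp [h2])⟩
      · simp only [spiderNode, Option.some.injEq, Sigma.mk.injEq] at h1
        obtain ⟨rfl, h2⟩ := h1
        simp only [heq_eq_eq, Fin.mk.injEq] at h2
        exact ⟨rfl, Or.inl (by simp [h2])⟩

theorem spider_adj_node {i : Fin l.length} {k : ℕ} (h : k + 1 ≤ l.get i) :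
    (spider l).Adj (spiderNode l i (k + 1) h) (spiderNode l i k (Nat.le_of_succ_le h)) :=
  (spider_adj_node_succ h _).2 (Or.inl rfl)

theorem spider_exists_walk {i : Fin l.length} (k m : ℕ) (h : k + m ≤ l.get i) :
    ∃ p : (spider l).Walk (spiderNode l i (k + m) h) (spiderNode l i k (by omega)),
      p.length = m := by
  induction m with
  | zero => exact ⟨SimpleGraph.Walk.nil, rfl⟩
  | succ m ih =>
    obtain ⟨p, hp⟩ := ih (by omega)
    exact ⟨SimpleGraph.Walk.cons (spider_adj_node (k := k + m) h) p, by simp [hp]⟩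

theorem spider_dist_node_le {i : Fin l.length} (k m : ℕ) (h : k + m ≤ l.get i) :
    (spider l).dist (spiderNode l i (k + m) h) (spiderNode l i k (by omega)) ≤ m := by
  obtain ⟨p, hp⟩ := spider_exists_walk k m h
  exact (SimpleGraph.dist_le p).trans hp.le

theorem spider_dist_none_le {i : Fin l.length} (k : ℕ) (h : k ≤ l.get i) :
    (spider l).dist (spiderNode l i k h) none ≤ k := by
  have := spider_dist_node_le (l := l) (i := i) 0 k (by omega)
  simp only [Nat.zero_add] at this
  exact this

theorem spider_connected (l : List ℕ) : (spider l).Connected := by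
  have key : ∀ x, (spider l).Reachable x none := by
    intro x
    rcases eq_none_or_spiderNode x with rfl | ⟨i, k, h, rfl⟩
    · exact SimpleGraph.Reachable.refl _
    · obtain ⟨p, -⟩ := spider_exists_walk (i := i) 0 (k + 1) (by omega)
      simpa [spiderNode] using p.reachable
  have : Nonempty (Option (Σ i : Fin l.length, Fin (l.get i))) := ⟨none⟩
  exact ⟨fun x y => (key x).trans (key y).symm⟩

/-- A connected finite graph all whose edges join a vertex to its parent is a tree. -/
theorem SimpleGraph.Connected.isTree_of_parent {V : Type*} [Finite V] {G : SimpleGraph V}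
    (hG : G.Connected) (c : V) (par : V → V)
    (h : ∀ x y, G.Adj x y → (x ≠ c ∧ par x = y) ∨ (y ≠ c ∧ par y = x)) : G.IsTree := by
  classical
  have := Fintype.ofFinite V
  rw [SimpleGraph.isTree_iff_connected_and_card]
  refine ⟨hG, le_antisymm ?_ hG.card_vert_le_card_edgeSet_add_one⟩
  -- There are at most |V| - 1 parent edges, the minimum for a connected graph.
  have h1 : G.edgeSet ⊆ ((Finset.univ.erase c).image fun v => s(v, par v) : Finset (Sym2 V)) := by
    intro e
    induction e with
    | _ x y =>
      intro he
      rw [Finset.mem_coe, Finset.mem_image]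
      rcases h x y he with ⟨hx, rfl⟩ | ⟨hy, rfl⟩
      · exact ⟨x, by simp [hx], rfl⟩
      · exact ⟨y, by simp [hy], Sym2.eq_swap⟩
  have h2 := Set.ncard_le_ncard h1 (Finset.finite_toSet _)
  rw [Set.ncard_coe_finset] at h2
  have h3 : Nat.card G.edgeSet = G.edgeSet.ncard := rfl
  have h4 := h2.trans Finset.card_image_le
  rw [Finset.card_erase_of_mem (Finset.mem_univ c), Finset.card_univ] at h4
  have : 0 < Fintype.card V := Fintype.card_pos_iff.2 ⟨c⟩
  rw [h3, Nat.card_eq_fintype_card]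
  omega

theorem spider_isTree (l : List ℕ) : (spider l).IsTree := by
  let par : Option (Σ i : Fin l.length, Fin (l.get i)) →
      Option (Σ i : Fin l.length, Fin (l.get i)) := fun x =>
    match x with
    | none => none
    | some ⟨i, j⟩ => spiderNode l i j j.2.le
  refine (spider_connected l).isTree_of_parent none par fun x y hxy => ?_
  rcases eq_none_or_spiderNode x with rfl | ⟨i, k, h, rfl⟩
  · rcases eq_none_or_spiderNode y with rfl | ⟨i, k, h, rfl⟩
    · exact absurd hxy (SimpleGraph.irrefl _)
    · refine Or.inr ⟨by simp [spiderNode], ?_⟩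
      rcases (spider_adj_node_succ h _).1 hxy.symm with h' | ⟨h', h''⟩
      · exact h'.symm
      · simp [spiderNode] at h''
  · rcases (spider_adj_node_succ h _).1 hxy with rfl | ⟨h', rfl⟩
    · exact Or.inl ⟨by simp [spiderNode], rfl⟩
    · exact Or.inr ⟨by simp [spiderNode], rfl⟩

theorem sum_fin_get {M : Type*} [AddCommMonoid M] (l : List ℕ) (g : ℕ → M) :
    ∑ i : Fin l.length, g (l.get i) = (l.map g).sum := by
  rw [← List.sum_ofFn]
  congr 1
  exact List.ext_get (by simp) (by simp)

theorem spider_card (l : List ℕ) :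
    Fintype.card (Option (Σ i : Fin l.length, Fin (l.get i))) = l.sum + 1 := by
  rw [Fintype.card_option, Fintype.card_sigma]
  simp only [Fintype.card_fin]
  rw [sum_fin_get l fun k => k]
  simp

/-- Only the first branch may exceed r, so two different branches span at most 2r + 1. -/
theorem get_cons_cons {r : ℕ} {L : List ℕ} (hL : ∀ k ∈ L, k ≤ r)
    (i : Fin ((r + 1) :: r :: L).length) :
    ((r + 1) :: r :: L).get i ≤ if (i : ℕ) = 0 then r + 1 else r := by
  obtain ⟨i, hi⟩ := i
  rcases i with _ | _ | i
  · simp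
  · simp
  · simp only [List.length_cons] at hi
    have : i < L.length := by omega
    simpa using hL _ (List.getElem_mem this)

theorem spider_diam {r : ℕ} (hr : 1 ≤ r) {L : List ℕ} (hL : ∀ k ∈ L, k ≤ r) :
    (spider ((r + 1) :: r :: L)).diam = 2 * r + 1 := by
  set l := (r + 1) :: r :: L with hl
  have hconn := spider_connected l
  have : Nonempty (Option (Σ i : Fin l.length, Fin (l.get i))) := ⟨none⟩
  refine le_antisymm ?_ ?_
  · obtain ⟨x, y, hxy⟩ := (spider l).exists_dist_eq_diam
    rw [← hxy]
    have htri := hconn.dist_triangle (u := x) (v := none) (w := y)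
    have hnode : ∀ i k (h : k + 1 ≤ l.get i), k + 1 ≤ r + 1 ∧ ((i : ℕ) ≠ 0 → k + 1 ≤ r) := by
      intro i k h
      have := h.trans (get_cons_cons hL i)
      split_ifs at this with h0
      · exact ⟨this, fun h => absurd h0 h⟩
      · exact ⟨by omega, fun _ => this⟩
    rcases eq_none_or_spiderNode x with rfl | ⟨i, k, h, rfl⟩
    · rcases eq_none_or_spiderNode y with rfl | ⟨i, k, h, rfl⟩
      · simp
      · have := spider_dist_none_le (k + 1) h
        have := hnode i k h
        rw [SimpleGraph.dist_comm]
        omega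
    · have h1 := spider_dist_none_le (k + 1) h
      have h2 := hnode i k h
      rcases eq_none_or_spiderNode y with rfl | ⟨i', k', h', rfl⟩
      · omega
      · have h3 := spider_dist_none_le (k' + 1) h'
        have h4 := hnode i' k' h'
        rw [SimpleGraph.dist_comm (u := none)] at htri
        by_cases hi : i = i'
        · subst hi
          rcases le_total k k' with hk | hk
          · obtain ⟨m, rfl⟩ := Nat.exists_eq_add_of_le hk
            have := spider_dist_node_le (i := i) (k + 1) m (by omega)
            rw [SimpleGraph.dist_comm]
            simp only [Nat.add_right_comm k 1 m] at this
            omega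
          · obtain ⟨m, rfl⟩ := Nat.exists_eq_add_of_le hk
            have := spider_dist_node_le (i := i) (k' + 1) m (by omega)
            simp only [Nat.add_right_comm k' 1 m] at this
            omega
        · have : (i : ℕ) ≠ 0 ∨ (i' : ℕ) ≠ 0 := by
            by_contra! h0
            exact hi (Fin.ext (h0.1.trans h0.2.symm))
          omega
  · let g : Option (Σ i : Fin l.length, Fin (l.get i)) → ℝ := fun x =>
      match x with
      | none => 0
      | some ⟨i, j⟩ => if (i : ℕ) = 0 then (j : ℝ) + 1 else -((j : ℝ) + 1)
    have hg' : ∀ i k h, g (spiderNode l i k h) = if (i : ℕ) = 0 then (k : ℝ) else -(k : ℝ) := by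
      intro i k h
      cases k with
      | zero => simp [spiderNode, g]
      | succ k => simp [spiderNode, g]
    have hstep : ∀ i k (h : k + 1 ≤ l.get i), |g (spiderNode l i (k + 1) h) -
        g (spiderNode l i k (Nat.le_of_succ_le h))| ≤ 1 := by
      intro i k h
      rw [hg', hg']
      push_cast
      split_ifs <;> rw [abs_le] <;> constructor <;> linarith
    have hg : ∀ x y, (spider l).Adj x y → |g x - g y| ≤ 1 := by
      intro x y hxy
      rcases eq_none_or_spiderNode x with rfl | ⟨i, k, h, rfl⟩
      · rcases eq_none_or_spiderNode y with rfl | ⟨i, k, h, rfl⟩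
        · simp
        · rcases (spider_adj_node_succ h _).1 hxy.symm with h' | ⟨h', h''⟩
          · rw [h', abs_sub_comm]; exact hstep i k h
          · simp [spiderNode] at h''
      · rcases (spider_adj_node_succ h _).1 hxy with rfl | ⟨h', rfl⟩
        · exact hstep i k h
        · rw [abs_sub_comm]; exact hstep i (k + 1) h'
    have h0 : 0 < l.length := by simp [hl]
    have h1 : 1 < l.length := by simp [hl]
    have hd := abs_sub_le_mul_dist hconn hg (spiderNode l ⟨0, h0⟩ (r + 1) le_rfl)
      (spiderNode l ⟨1, h1⟩ r le_rfl)
    rw [hg', hg', one_mul] at hd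
    simp only [if_true, one_ne_zero, if_false, sub_neg_eq_add] at hd
    have hd' := (le_abs_self _).trans hd
    have hle := SimpleGraph.dist_le_diam (SimpleGraph.connected_iff_ediam_ne_top.1 hconn)
      (u := spiderNode l ⟨0, h0⟩ (r + 1) le_rfl) (v := spiderNode l ⟨1, h1⟩ r le_rfl)
    have h2 : ((2 * r + 1 : ℕ) : ℝ) ≤ ((spider l).dist (spiderNode l ⟨0, h0⟩ (r + 1) le_rfl)
        (spiderNode l ⟨1, h1⟩ r le_rfl) : ℕ) := by
      refine le_trans ?_ hd'
      push_cast
      linarith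
    exact (Nat.cast_le.1 h2).trans hle

theorem spider_isTreeOfOrderDiam {r : ℕ} (hr : 1 ≤ r) {L : List ℕ} (hL : ∀ k ∈ L, k ≤ r) :
    IsTreeOfOrderDiam (2 * r + 2 + L.sum) (2 * r + 1) (spider ((r + 1) :: r :: L)) := by
  refine ⟨spider_isTree _, ?_, spider_diam hr hL⟩
  rw [spider_card]
  simp only [List.sum_cons]
  omega

end Spider

/-! ### Steklov eigenfunctions of spiders and the secular equation. -/

section SpiderEigen

open Finset

variable {l : List ℕ}

theorem spiderNode_inj {i : Fin l.length} {k k' : ℕ} {h : k ≤ l.get i} {h' : k' ≤ l.get i}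
    (e : spiderNode l i k h = spiderNode l i k' h') : k = k' := by
  cases k <;> cases k' <;> simp_all [spiderNode]

theorem graphLaplacian_spiderNode (f : Option (Σ i : Fin l.length, Fin (l.get i)) → ℝ)
    {i : Fin l.length} {k : ℕ} (h : k + 2 ≤ l.get i) :
    graphLaplacian (spider l) f (spiderNode l i (k + 1) (by omega)) =
      2 * f (spiderNode l i (k + 1) (by omega)) - f (spiderNode l i k (by omega)) -
        f (spiderNode l i (k + 2) h) := by
  classical
  have hne : spiderNode l i k (by omega) ≠ spiderNode l i (k + 2) h := fun e => by
    have := spiderNode_inj e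
    omega
  have hfilter : univ.filter (fun y => (spider l).Adj (spiderNode l i (k + 1) (by omega)) y) =
      {spiderNode l i k (by omega), spiderNode l i (k + 2) h} := by
    ext y
    simp only [mem_filter, mem_univ, true_and, mem_insert, mem_singleton]
    rw [spider_adj_node_succ (by omega)]
    exact or_congr Iff.rfl ⟨fun ⟨_, h⟩ => h, fun h' => ⟨h, h'⟩⟩
  rw [graphLaplacian]
  calc _ = ∑ y ∈ {spiderNode l i k (by omega), spiderNode l i (k + 2) h},
        (f (spiderNode l i (k + 1) (by omega)) - f y) := by
        rw [← hfilter]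
    _ = _ := by
        rw [sum_pair hne]
        ring

theorem graphLaplacian_spider_none (hl : ∀ i : Fin l.length, 1 ≤ l.get i)
    (f : Option (Σ i : Fin l.length, Fin (l.get i)) → ℝ) :
    graphLaplacian (spider l) f none = ∑ i, (f none - f (spiderNode l i 1 (hl i))) := by
  classical
  rw [graphLaplacian_eq, Fintype.sum_option, if_neg (SimpleGraph.irrefl _), zero_add,
    Fintype.sum_sigma]
  refine sum_congr rfl fun i _ => ?_
  rw [sum_eq_single (⟨0, hl i⟩ : Fin (l.get i))]
  · rw [if_pos (spider_adj_none_some.2 rfl)]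
    rfl
  · intro j _ hj
    rw [if_neg]
    rw [spider_adj_none_some]
    exact fun h => hj (Fin.ext h)
  · simp

theorem isLeafVertex_spiderNode {i : Fin l.length} {k : ℕ} (h : k + 1 = l.get i) :
    IsLeafVertex (spider l) (spiderNode l i (k + 1) h.le) := by
  refine ⟨spiderNode l i k (by omega), spider_adj_node h.le, fun y hy => ?_⟩
  exact ((spider_adj_node_succ h.le y).1 hy).resolve_right fun ⟨h', _⟩ => by omega

theorem not_isLeafVertex_spiderNode {i : Fin l.length} {k : ℕ} (h : k + 2 ≤ l.get i) :
    ¬ IsLeafVertex (spider l) (spiderNode l i (k + 1) (by omega)) := by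
  intro hleaf
  have := spiderNode_inj (hleaf.unique (spider_adj_node (by omega))
    ((spider_adj_node_succ (by omega) _).2 (Or.inr ⟨h, rfl⟩)))
  omega

theorem not_isLeafVertex_spider_none (hl : ∀ i : Fin l.length, 1 ≤ l.get i)
    (h2 : 2 ≤ l.length) : ¬ IsLeafVertex (spider l) none := by
  intro hleaf
  have h := hleaf.unique (spider_adj_node (hl ⟨0, by omega⟩)).symm
    (spider_adj_node (hl ⟨1, by omega⟩)).symm
  simp [spiderNode] at h

/-- The recursion is solved inwards from the leaf N; m is the distance to it. -/
theorem eq_of_harmonic_of_steklov {u : ℕ → ℝ} {N : ℕ} {lam : ℝ}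
    (h1 : ∀ k, k + 2 ≤ N → 2 * u (k + 1) - u k - u (k + 2) = 0)
    (h2 : ∀ k, k + 1 = N → u (k + 1) - u k = lam * u (k + 1)) (m : ℕ) (hm : m ≤ N) :
    u (N - m) = (1 - lam * m) * u N := by
  induction m using Nat.twoStepInduction with
  | zero => simp
  | one =>
    obtain ⟨k, rfl⟩ : ∃ k, N = k + 1 := ⟨N - 1, by omega⟩
    have := h2 k rfl
    rw [Nat.add_sub_cancel]
    push_cast
    linarith
  | more m ih1 ih2 =>
    have e1 := ih1 (by omega)
    have e2 := ih2 (by omega)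
    obtain ⟨k, rfl⟩ : ∃ k, N = k + (m + 2) := ⟨N - (m + 2), by omega⟩
    have e3 := h1 k (by omega)
    rw [show k + (m + 2) - m = k + 2 by omega] at e1
    rw [show k + (m + 2) - (m + 1) = k + 1 by omega] at e2
    rw [show k + (m + 2) - (m + 2) = k by omega]
    push_cast at e2 ⊢
    linarith

/-- A Steklov eigenfunction is affine on each branch of a spider. -/
theorem spider_eigenfunction_branch {lam : ℝ}
    {f : Option (Σ i : Fin l.length, Fin (l.get i)) → ℝ}
    (h1 : ∀ v, ¬ IsLeafVertex (spider l) v → graphLaplacian (spider l) f v = 0)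
    (h2 : ∀ ω ω', IsLeafVertex (spider l) ω → (spider l).Adj ω ω' → f ω - f ω' = lam * f ω)
    (i : Fin l.length) (k m : ℕ) (h : k + m = l.get i) :
    f (spiderNode l i k (by omega)) = (1 - lam * m) * f (spiderNode l i (l.get i) le_rfl) := by
  let u : ℕ → ℝ := fun k => if h : k ≤ l.get i then f (spiderNode l i k h) else 0
  have hu : ∀ k h, f (spiderNode l i k h) = u k := fun k h => by
    simp only [u]
    rw [dif_pos h]
  have key := eq_of_harmonic_of_steklov (u := u) (N := l.get i) (lam := lam) ?_ ?_ m (by omega)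
  · rw [hu, hu, ← key]
    congr 1
    omega
  · intro k hk
    rw [← hu _ hk, ← hu (k + 1) (by omega), ← hu k (by omega), ← graphLaplacian_spiderNode f hk]
    exact h1 _ (not_isLeafVertex_spiderNode hk)
  · intro k hk
    rw [← hu _ hk.le, ← hu k (by omega)]
    exact h2 _ _ (isLeafVertex_spiderNode hk) (spider_adj_node hk.le)

/-- The secular equation for the Steklov eigenvalues of an almost seesaw spider. -/
theorem spider_secular {r : ℕ} (hr : 1 ≤ r) {L : List ℕ} (hL : ∀ k ∈ L, 1 ≤ k ∧ k ≤ r) {lam : ℝ}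
    (h0 : 0 < lam) (hlam : lam * r < 1)
    (hev : IsSteklovEigenvalue (spider ((r + 1) :: r :: L)) lam) :
    1 < lam * (r + 1) ∧ (response lam r - 1) *
      (response lam r - 1 + (L.map (response lam)).sum) = 1 := by
  set l := (r + 1) :: r :: L with hl
  obtain ⟨-, f, hf0, h1, h2⟩ := hev
  have hlpos : ∀ i : Fin l.length, 1 ≤ l.get i := by
    intro i
    have : ∀ k ∈ l, 1 ≤ k := by
      intro k hk
      simp only [hl, List.mem_cons] at hk
      rcases hk with rfl | rfl | hk
      · omega
      · exact hr
      · exact (hL k hk).1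
    exact this _ (List.get_mem l i)
  have hle : ∀ i : Fin l.length, (i : ℕ) ≠ 0 → l.get i ≤ r := by
    intro i hi
    have := get_cons_cons (fun k hk => (hL k hk).2) i
    rwa [if_neg hi] at this
  have hlen : 2 ≤ l.length := by simp [hl]
  let i₀ : Fin l.length := ⟨0, by omega⟩
  have hi₀ : l.get i₀ = r + 1 := rfl
  set x := f none with hx
  let a : Fin l.length → ℝ := fun i => f (spiderNode l i (l.get i) le_rfl)
  have hbr := spider_eigenfunction_branch h1 h2
  have hxa : ∀ i, x = (1 - lam * l.get i) * a i := fun i => hbr i 0 (l.get i) (by omega)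
  -- Harmonicity at the center: the flux through branch i is lam times its leaf value, up to sign.
  have hflux : ∑ i, a i = 0 := by
    have h := h1 none (not_isLeafVertex_spider_none hlpos hlen)
    rw [graphLaplacian_spider_none hlpos] at h
    have h3 : ∀ i, f none - f (spiderNode l i 1 (hlpos i)) = -lam * a i := by
      intro i
      obtain ⟨m, hm⟩ : ∃ m, 1 + m = l.get i := ⟨l.get i - 1, by have := hlpos i; omega⟩
      have hm' : (1 : ℝ) + m = l.get i := by exact_mod_cast hm
      rw [← hx, hxa i, hbr i 1 m hm, ← hm']
      simp only [a]
      ring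
    rw [sum_congr rfl fun i _ => h3 i, ← mul_sum] at h
    exact (mul_eq_zero.1 h).resolve_left (by linarith)
  have hpos : ∀ k : ℕ, k ≤ r → 0 < 1 - lam * k := by
    intro k hk
    have : (k : ℝ) ≤ r := by exact_mod_cast hk
    nlinarith
  have hne : ∀ i : Fin l.length, (i : ℕ) ≠ 0 → 1 - lam * l.get i ≠ 0 := fun i hi => (hpos _ (hle i hi)).ne'
  -- If the center value vanished, f would vanish on every branch of length at most r, and then the
  -- flux condition kills the long branch. A separate argument is needed there because 1 - lam (r+1)
  -- might be 0.
  have hx0 : x ≠ 0 := by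
    intro hx0
    have ha : ∀ i, i ≠ i₀ → a i = 0 := by
      intro i hi
      have hi' : (i : ℕ) ≠ 0 := fun h => hi (Fin.ext h)
      have := hxa i
      rw [hx0] at this
      exact (mul_eq_zero.1 this.symm).resolve_left (hne i hi')
    have ha0 : a i₀ = 0 := by
      rw [sum_eq_single i₀ (fun i _ hi => ha i hi) (by simp)] at hflux
      exact hflux
    refine hf0 (funext fun y => ?_)
    rcases eq_none_or_spiderNode y with rfl | ⟨i, k, h, rfl⟩
    · exact hx0
    · obtain ⟨m, hm⟩ := Nat.exists_eq_add_of_le h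
      rw [hbr i (k + 1) m hm.symm]
      change _ * a i = 0
      rcases eq_or_ne i i₀ with rfl | hi
      · rw [ha0, mul_zero]
      · rw [ha i hi, mul_zero]
  have hne' : ∀ i, 1 - lam * l.get i ≠ 0 := fun i h => hx0 (by rw [hxa i, h, zero_mul])
  have hsum : (l.map (response lam)).sum = 0 := by
    rw [← sum_fin_get]
    have h3 : ∀ i, response lam (l.get i) = lam / x * a i := by
      intro i
      rw [hxa i, response]
      have := hne' i
      have ha : a i ≠ 0 := fun h => hx0 (by rw [hxa i, h, mul_zero])
      field_simp
    rw [sum_congr rfl fun i _ => h3 i, ← mul_sum, hflux, mul_zero]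
  rw [hl, List.map_cons, List.map_cons, List.sum_cons, List.sum_cons] at hsum
  set S := (L.map (response lam)).sum with hS
  have hS0 : 0 ≤ S := by
    refine List.sum_nonneg fun y hy => ?_
    obtain ⟨k, hk, rfl⟩ := List.mem_map.1 hy
    exact (div_pos h0 (hpos k (hL k hk).2)).le
  have hp := hpos r le_rfl
  have hne0 := hne' i₀
  rw [hi₀] at hne0
  -- Otherwise all responses would be positive and could not sum to 0.
  have hgt : 1 < lam * (r + 1) := by
    by_contra hc
    have h4 : 0 < 1 - lam * (r + 1 : ℕ) := by
      refine lt_of_le_of_ne ?_ hne0.symm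
      push_cast
      linarith
    have h5 : 0 < response lam (r + 1) := div_pos h0 h4
    have h6 : 0 < response lam r := div_pos h0 hp
    linarith
  refine ⟨hgt, ?_⟩
  -- With p = `response lam r` one has `response lam (r + 1)` = p/(1-p), which turns the vanishing
  -- sum into the product form.
  have hS' : S = -(response lam (r + 1)) - response lam r := by linarith
  have h7 : 1 - lam * (r + 1) ≠ 0 := by exact_mod_cast hne0
  rw [hS', response, response]
  push_cast
  field_simp
  ring

end SpiderEigen

/-! ### Recognising a spider from its path decomposition. -/

namespace BicentralForest

open Finset Classical

variable {V : Type*} {G : SimpleGraph V} {r : ℕ} (B : BicentralForest G r)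

include B

theorem iterate_ch {w : V} {k : ℕ} (hk : k ≤ B.H w) :
    B.par^[k] (B.ch^[k] w) = w ∧ B.H (B.ch^[k] w) + k = B.H w ∧
      (k ≠ 0 → B.ch^[k] w ≠ B.a ∧ B.ch^[k] w ≠ B.c) := by
  induction k with
  | zero => simp
  | succ k ih =>
    obtain ⟨h1, h2, -⟩ := ih (by omega)
    obtain ⟨e1, e2, e3, e4⟩ := B.ch_spec (B.ch^[k] w) (by omega)
    rw [Function.iterate_succ_apply' B.ch, Function.iterate_succ_apply, e1]
    exact ⟨h1, by omega, fun _ => ⟨e2, e3⟩⟩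

variable [Fintype V]

theorem swap_tops : B.swap.tops = B.tops := by
  ext v
  rw [tops, tops, mem_filter, mem_filter]
  change (_ ∧ v ≠ B.c ∧ v ≠ B.a ∧ B.ch (B.par v) ≠ v) ↔ _
  tauto

theorem tops_spec {v : V} (hv : v ∈ B.tops) : v ≠ B.a ∧ v ≠ B.c ∧ B.ch (B.par v) ≠ v := by
  simpa [tops] using hv

-- `spider` depends on the order of its list; this reorders the path tops so that their lengths come
-- out in a prescribed order.
omit B [Fintype V] in
theorem exists_perm_map_eq {α β : Type*} (f : α → β) {l : List α} {m : List β}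
    (h : (l.map f).Perm m) : ∃ l', l.Perm l' ∧ l'.map f = m := by
  induction m generalizing l with
  | nil =>
    have : l = [] := by simpa using h
    exact ⟨[], by rw [this], rfl⟩
  | cons b m ih =>
    have hb : b ∈ l.map f := h.mem_iff.2 (List.mem_cons_self ..)
    obtain ⟨x, hx, rfl⟩ := List.mem_map.1 hb
    have hp := List.perm_cons_erase hx
    have h3 : ((l.erase x).map f).Perm m := by
      have := (hp.map f).symm.trans h
      rw [List.map_cons] at this
      exact this.cons_inv
    obtain ⟨l', h4, h5⟩ := ih h3
    exact ⟨x :: l', hp.trans (h4.cons x), by rw [List.map_cons, h5]⟩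

/-- The list `ws` holds the first vertices of branches at c, and vertex j of a branch is the j-th
iterated selected child. Branches are disjoint, the count makes the map bijective, and edges go to
edges; a connected spanning subgraph of a tree is the whole tree. -/
theorem iso_spider_map (hG : G.IsTree) {ws : List V} (hnodup : ws.Nodup)
    (hw : ∀ w ∈ ws, w = B.a ∨ (w ≠ B.a ∧ w ≠ B.c ∧ B.par w = B.c))
    (hcard : Fintype.card V = (ws.map fun w => B.H w + 1).sum + 1) :
    Nonempty (G ≃g spider (ws.map fun w => B.H w + 1)) := by
  set l := ws.map fun w => B.H w + 1 with hl
  have hlen : l.length = ws.length := by simp [hl]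
  let t : Fin l.length → V := fun i => ws.get (i.cast hlen)
  have ht : ∀ i, l.get i = B.H (t i) + 1 := fun i => by simp [hl, t]
  have hwc : ∀ i, t i ≠ B.c := by
    intro i
    rcases hw (t i) (List.get_mem _ _) with h | h
    · rw [h]; exact B.ne
    · exact h.2.1
  have htinj : ∀ i i', t i = t i' → i = i' := by
    intro i i' h
    have := (List.nodup_iff_injective_get.1 hnodup) h
    exact Fin.ext (by simpa using congrArg Fin.val this)
  let φ : Option (Σ i : Fin l.length, Fin (l.get i)) → V := fun x =>
    match x with
    | none => B.c
    | some ⟨i, j⟩ => B.ch^[j] (t i)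
  -- Going up k steps shows that one branch start is the m-th iterated selected child of another.
  -- For m > 0 it is not a root, so its parent is c and the other branch would pass through c.
  have hiter : ∀ i i' (k k' : ℕ), k ≤ B.H (t i) → k' ≤ B.H (t i') → k ≤ k' →
      B.ch^[k] (t i) = B.ch^[k'] (t i') → i = i' ∧ k = k' := by
    intro i i' k k' hk hk' hkk h
    obtain ⟨m, rfl⟩ := Nat.exists_eq_add_of_le hkk
    rw [Function.iterate_add_apply] at h
    have h1 := congrArg (B.par^[k]) h
    have h2 := B.iterate_ch (w := t i') (k := m) (by omega)
    rw [(B.iterate_ch hk).1, (B.iterate_ch (w := B.ch^[m] (t i')) (by omega)).1] at h1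
    cases m with
    | zero => exact ⟨htinj _ _ h1, rfl⟩
    | succ m =>
      exfalso
      obtain ⟨-, h3, h4⟩ := h2
      obtain ⟨h5, h6⟩ := h4 (by omega)
      rw [← h1] at h5 h6
      rcases hw (t i) (List.get_mem _ _) with h7 | ⟨-, -, h7⟩
      · exact h5 h7
      · obtain ⟨e1, -⟩ := B.ch_spec (B.ch^[m] (t i'))
          (by have := (B.iterate_ch (w := t i') (k := m) (by omega)).2.1; omega)
        rw [← Function.iterate_succ_apply' B.ch, ← h1, h7] at e1
        cases m with
        | zero => exact hwc i' e1.symm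
        | succ m =>
          exact ((B.iterate_ch (w := t i') (k := m + 1) (by omega)).2.2 (by omega)).2 e1.symm
  have hc : ∀ i (k : ℕ), k ≤ B.H (t i) → B.ch^[k] (t i) ≠ B.c := by
    intro i k hk
    cases k with
    | zero => exact hwc i
    | succ k => exact ((B.iterate_ch hk).2.2 (by omega)).2
  have hlt : ∀ (i : Fin l.length) (j : Fin (l.get i)), (j : ℕ) ≤ B.H (t i) := by
    intro i j
    have h1 := j.2
    have h2 := ht i
    omega
  have hinj : Function.Injective φ := by
    rintro (_ | ⟨i, j⟩) (_ | ⟨i', j'⟩) h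
    · rfl
    · exact absurd h.symm (hc i' j' (hlt i' j'))
    · exact absurd h (hc i j (hlt i j))
    · have : i = i' ∧ (j : ℕ) = j' := by
        rcases le_total (j : ℕ) j' with hj | hj
        · exact hiter i i' j j' (hlt i j) (hlt i' j') hj h
        · have := hiter i' i j' j (hlt i' j') (hlt i j) hj h.symm
          exact ⟨this.1.symm, this.2.symm⟩
      obtain ⟨rfl, h2⟩ := this
      rw [Fin.ext h2]
  have hbij : Function.Bijective φ := by
    rw [Fintype.bijective_iff_injective_and_card]
    exact ⟨hinj, by rw [spider_card, hcard]⟩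
  let e := Equiv.ofBijective φ hbij
  have hstep : ∀ i k (h : k + 1 ≤ l.get i),
      G.Adj (φ (spiderNode l i (k + 1) h)) (φ (spiderNode l i k (by omega))) := by
    intro i k h
    have h2 := ht i
    cases k with
    | zero =>
      change G.Adj (t i) B.c
      rcases hw (t i) (List.get_mem _ _) with h7 | ⟨h8, h9, h7⟩
      · rw [h7]; exact B.adj_roots
      · have := B.adj_par h8 h9
        rwa [h7] at this
    | succ k =>
      change G.Adj (B.ch^[k + 1] (t i)) (B.ch^[k] (t i))
      rw [Function.iterate_succ_apply']
      refine (B.adj_ch ?_).symm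
      have := (B.iterate_ch (w := t i) (k := k) (by omega)).2.1
      omega
  have hle : spider l ≤ G.comap e := by
    intro x y hxy
    change G.Adj (φ x) (φ y)
    rcases eq_none_or_spiderNode x with rfl | ⟨i, k, h, rfl⟩
    · rcases eq_none_or_spiderNode y with rfl | ⟨i, k, h, rfl⟩
      · exact absurd hxy (SimpleGraph.irrefl _)
      · rcases (spider_adj_node_succ h _).1 hxy.symm with h' | ⟨h', h''⟩
        · rw [h']; exact (hstep i k h).symm
        · simp [spiderNode] at h''
    · rcases (spider_adj_node_succ h _).1 hxy with rfl | ⟨h', rfl⟩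
      · exact hstep i k h
      · exact (hstep i (k + 1) h').symm
  have htree : (G.comap e).IsTree := (SimpleGraph.Iso.comap e G).isTree_iff.2 hG
  have heq : spider l = G.comap e := le_antisymm hle
    ((SimpleGraph.isTree_iff_minimal_connected.1 htree).2 (spider_connected l) hle)
  rw [heq]
  exact ⟨(SimpleGraph.Iso.comap e G).symm⟩

/-- If all path tops are children of the root `c`, the tree is a spider. -/
theorem iso_spider_of_tops (hG : G.IsTree) (hr : 1 ≤ r) (htops : ∀ v ∈ B.tops, B.par v = B.c)
    {L : List ℕ} (hL : (B.tops.toList.map fun v => B.H v + 1).Perm L) :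
    Nonempty (G ≃g spider ((r + 1) :: r :: L)) := by
  obtain ⟨us, hus, rfl⟩ := exists_perm_map_eq _ hL
  have hmem : ∀ v, v ∈ us ↔ v ∈ B.tops := fun v => by rw [← hus.mem_iff, mem_toList]
  obtain ⟨e1, e2, e3, e4⟩ := B.ch_spec B.c (by rw [B.H_c]; exact hr)
  rw [B.H_c] at e4
  -- With c as center, the branch of length r + 1 starts at a and that of length r at the selected
  -- child of c.
  have hlist : (r + 1) :: r :: us.map (fun v => B.H v + 1) =
      (B.a :: B.ch B.c :: us).map fun v => B.H v + 1 := by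
    simp [B.H_a, e4]
  have hnodup : us.Nodup := hus.nodup_iff.1 (nodup_toList _)
  rw [hlist]
  refine B.iso_spider_map hG ?_ ?_ ?_
  · rw [List.nodup_cons, List.nodup_cons]
    refine ⟨?_, ?_, hnodup⟩
    · rw [List.mem_cons, hmem]
      rintro (h | h)
      · exact e2 h.symm
      · exact (B.tops_spec h).1 rfl
    · rw [hmem]
      intro h
      have := (B.tops_spec h).2.2
      rw [e1] at this
      exact this rfl
  · intro w hw
    rw [List.mem_cons, List.mem_cons, hmem] at hw
    rcases hw with h | rfl | h
    · exact Or.inl h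
    · exact Or.inr ⟨e2, e3, e1⟩
    · exact Or.inr ⟨(B.tops_spec h).1, (B.tops_spec h).2.1, htops w h⟩
  · rw [← hlist, B.card_eq, List.sum_cons, List.sum_cons, ← sum_map_toList,
      (hus.map fun v => B.H v + 1).sum_eq]
    omega

end BicentralForest

/-! ### Minimising the total response over partitions of M. -/

section Optimisation

/-- The partition of `q * c + t` into `q` parts which differ by at most one. -/
abbrev balancedParts (q c t : ℕ) : List ℕ :=
  List.replicate t (c + 1) ++ List.replicate (q - t) c

theorem balancedParts_sum {q c t : ℕ} (ht : t < q) : (balancedParts q c t).sum = q * c + t := by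
  obtain ⟨m, rfl⟩ := Nat.exists_eq_add_of_le ht.le
  simp only [List.sum_append, List.sum_replicate, smul_eq_mul, Nat.add_sub_cancel_left]
  ring

theorem balancedParts_length {q c t : ℕ} (ht : t < q) : (balancedParts q c t).length = q := by
  simp
  omega

theorem mem_balancedParts {q c t k : ℕ} (hk : k ∈ balancedParts q c t) :
    k = c ∨ (k = c + 1 ∧ 0 < t) := by
  rw [List.mem_append, List.mem_replicate, List.mem_replicate] at hk
  omega

theorem exists_perm_replicate {e : ℕ} {l : List ℕ} (hl : ∀ k ∈ l, k = e ∨ k = e + 1) :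
    ∃ t ≤ l.length, l.Perm (balancedParts l.length e t) ∧ l.sum = l.length * e + t := by
  induction l with
  | nil => exact ⟨0, le_rfl, by simp, by simp⟩
  | cons a l ih =>
    obtain ⟨t, ht, hp, hs⟩ := ih fun k hk => hl k (List.mem_cons_of_mem _ hk)
    rcases hl a (List.mem_cons_self ..) with rfl | rfl
    · refine ⟨t, by simp; omega, ?_, by simp [hs]; ring⟩
      have : (a :: l).length - t = l.length - t + 1 := by simp; omega
      rw [balancedParts, this, List.replicate_succ]
      exact (hp.cons a).trans List.perm_middle.symm
    · refine ⟨t + 1, by simp; omega, ?_, by simp [hs]; ring⟩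
      have : ((e + 1) :: l).length - (t + 1) = l.length - t := by simp
      rw [balancedParts, this, List.replicate_succ]
      exact hp.cons (e + 1)

/-- Length and sum determine how often e + 1 occurs. -/
theorem perm_of_mem_pair {e : ℕ} {l l' : List ℕ} (hl : ∀ k ∈ l, k = e ∨ k = e + 1)
    (hl' : ∀ k ∈ l', k = e ∨ k = e + 1) (hlen : l.length = l'.length) (hsum : l.sum = l'.sum) :
    l.Perm l' := by
  obtain ⟨t, -, hp, hs⟩ := exists_perm_replicate hl
  obtain ⟨t', -, hp', hs'⟩ := exists_perm_replicate hl'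
  rw [hlen] at hp hs
  obtain rfl : t = t' := by omega
  exact hp.trans hp'.symm

/-- An affine minorant reduces the sum to length and total; P records where it touches g, and
equality puts every entry there. -/
theorem supporting_line_le_sum {g : ℕ → ℝ} {α β : ℝ} {P : ℕ → Prop} {l : List ℕ}
    (h : ∀ k ∈ l, α + β * k ≤ g k) (hP : ∀ k ∈ l, g k = α + β * k → P k) :
    α * l.length + β * l.sum ≤ (l.map g).sum ∧
      ((l.map g).sum = α * l.length + β * l.sum → ∀ k ∈ l, P k) := by
  induction l with
  | nil => simp
  | cons a l ih =>
    obtain ⟨h1, h2⟩ := ih (fun k hk => h k (List.mem_cons_of_mem _ hk))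
      fun k hk => hP k (List.mem_cons_of_mem _ hk)
    have ha := h a (List.mem_cons_self ..)
    simp only [List.map_cons, List.sum_cons, List.length_cons, Nat.cast_add, Nat.cast_one]
    refine ⟨by linarith, fun heq k hk => ?_⟩
    rcases List.mem_cons.1 hk with rfl | hk
    · exact hP k (List.mem_cons_self ..) (by linarith)
    · exact h2 (by linarith) k hk

theorem sum_eq_of_affine {g : ℕ → ℝ} {α β : ℝ} {l : List ℕ} (h : ∀ k ∈ l, g k = α + β * k) :
    (l.map g).sum = α * l.length + β * l.sum := by
  induction l with
  | nil => simp
  | cons a l ih =>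
    rw [List.map_cons, List.sum_cons, ih fun k hk => h k (List.mem_cons_of_mem _ hk),
      h a (List.mem_cons_self ..), List.length_cons, List.sum_cons]
    push_cast
    ring

variable {lam : ℝ} {r s : ℕ}

theorem one_sub_mul_pos (h0 : 0 < lam) (hlam : lam * r < 1) {k : ℕ} (hk : k ≤ r) :
    0 < 1 - lam * k := by
  have : (k : ℝ) ≤ r := by exact_mod_cast hk
  nlinarith

/-- The chord of `response lam` over `[e, e + 1]` supports it at the integers. -/
theorem exists_chord (h0 : 0 < lam) (hlam : lam * r < 1) {e : ℕ} (he : e + 1 ≤ r) :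
    ∃ α β : ℝ, (∀ k ≤ r, α + β * k ≤ response lam k) ∧
      (∀ k ≤ r, response lam k = α + β * k ↔ k = e ∨ k = e + 1) ∧
      (lam * (2 * e + 1) < 1 → 0 < α) ∧ (1 < lam * (2 * e + 1) → α < 0) := by
  have p1 := one_sub_mul_pos h0 hlam (Nat.le_of_succ_le he)
  have p2 := one_sub_mul_pos h0 hlam he
  -- The intercept of the chord is the price of one more part when the total is fixed.
  have hα : (e + 1) * response lam e - e * response lam (e + 1) =
      lam * (1 - lam * (2 * e + 1)) / ((1 - lam * e) * (1 - lam * (e + 1 : ℕ))) := by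
    have h1 : response lam e * (1 - lam * e) = lam := div_mul_cancel₀ _ p1.ne'
    have h2 : response lam (e + 1) * (1 - lam * (e + 1 : ℕ)) = lam := div_mul_cancel₀ _ p2.ne'
    rw [eq_div_iff (mul_pos p1 p2).ne']
    push_cast at h2 ⊢
    linear_combination (e + 1) * (1 - lam * (e + 1)) * h1 - e * (1 - lam * e) * h2
  -- The factor (k-e)(k-e-1) is nonnegative at integers and vanishes only at e and e + 1.
  have hdiff : ∀ k ≤ r, response lam k - ((e + 1) * response lam e - e * response lam (e + 1) +
      (response lam (e + 1) - response lam e) * k) =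
      lam ^ 3 / ((1 - lam * k) * (1 - lam * e) * (1 - lam * (e + 1 : ℕ))) *
        (((k : ℝ) - e) * (k - (e + 1 : ℕ))) := by
    intro k hk
    have p3 := one_sub_mul_pos h0 hlam hk
    rw [response, response, response]
    field_simp
    push_cast
    ring
  have hcoef : ∀ k ≤ r,
      0 < lam ^ 3 / ((1 - lam * k) * (1 - lam * e) * (1 - lam * (e + 1 : ℕ))) := by
    intro k hk
    have p3 := one_sub_mul_pos h0 hlam hk
    positivity
  refine ⟨(e + 1) * response lam e - e * response lam (e + 1),
    response lam (e + 1) - response lam e, fun k hk => ?_, fun k hk => ?_, fun h => ?_,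
    fun h => ?_⟩
  · rw [← sub_nonneg, hdiff k hk]
    refine mul_nonneg (hcoef k hk).le ?_
    rcases Nat.lt_or_ge e k with h | h
    · have h1 : ((e + 1 : ℕ) : ℝ) ≤ k := by exact_mod_cast h
      have h2 : (e : ℝ) ≤ k := by exact_mod_cast h.le
      exact mul_nonneg (by linarith) (by linarith)
    · have h1 : (k : ℝ) ≤ e := by exact_mod_cast h
      have h2 : (k : ℝ) ≤ (e + 1 : ℕ) := by exact_mod_cast h.trans (Nat.le_succ e)
      exact mul_nonneg_of_nonpos_of_nonpos (by linarith) (by linarith)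
  · rw [← sub_eq_zero, hdiff k hk, mul_eq_zero, or_iff_right (hcoef k hk).ne', mul_eq_zero,
      sub_eq_zero, sub_eq_zero]
    norm_cast
  · rw [hα]
    have : 0 < 1 - lam * (2 * e + 1) := by linarith
    positivity
  · rw [hα]
    refine div_neg_of_neg_of_pos ?_ (mul_pos p1 p2)
    exact mul_neg_of_pos_of_neg h0 (by linarith)

/-- A minorant through the origin makes the number of parts irrelevant. The difference is a positive
multiple of (s-k)(1-lam(s+k)); since 2s is r or r + 1, both factors are positive for k < s and
negative for k > s. -/
theorem response_ge_ray (h0 : 0 < lam) (hlam : lam * r < 1) (hlam' : 1 < lam * (r + 1))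
    (hs0 : 1 ≤ s) (hs1 : r ≤ 2 * s) (hs2 : 2 * s ≤ r + 1) (hsr : s ≤ r) {k : ℕ}
    (hk : k ≤ r) :
    response lam s / s * k ≤ response lam k ∧
      (response lam k = response lam s / s * k → k = s) := by
  have p1 := one_sub_mul_pos h0 hlam hk
  have p2 := one_sub_mul_pos h0 hlam hsr
  have hs0' : (0 : ℝ) < s := by exact_mod_cast hs0
  have hdiff : response lam k - response lam s / s * k =
      lam / ((1 - lam * k) * (1 - lam * s) * s) *
        (((s : ℝ) - k) * (1 - lam * (s + k : ℕ))) := by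
    rw [response, response]
    field_simp
    push_cast
    ring
  have hcoef : 0 < lam / ((1 - lam * k) * (1 - lam * s) * s) := by positivity
  have hpos : k ≠ s → 0 < ((s : ℝ) - k) * (1 - lam * (s + k : ℕ)) := by
    intro hne
    rcases lt_or_gt_of_ne hne with h | h
    · have h1 : (k : ℝ) < s := by exact_mod_cast h
      exact mul_pos (by linarith) (one_sub_mul_pos h0 hlam (by omega))
    · have h1 : (s : ℝ) < k := by exact_mod_cast h
      have h2 : (r : ℝ) + 1 ≤ (s + k : ℕ) := by exact_mod_cast (by omega : r + 1 ≤ s + k)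
      exact mul_pos_of_neg_of_neg (by linarith) (by nlinarith)
  constructor
  · rw [← sub_nonneg, hdiff]
    rcases eq_or_ne k s with rfl | hne
    · simp
    · exact (mul_pos hcoef (hpos hne)).le
  · intro h
    by_contra hne
    rw [← sub_eq_zero, hdiff] at h
    exact (mul_pos hcoef (hpos hne)).ne' h

/-- Comparison of a list of path lengths with a list supported on two consecutive lengths. -/
theorem sum_response_le_of_chord (h0 : 0 < lam) (hlam : lam * r < 1) {e : ℕ} (he : e + 1 ≤ r)
    {l l₀ : List ℕ} (hl : ∀ k ∈ l, k ≤ r) (hl₀ : ∀ k ∈ l₀, k = e ∨ k = e + 1)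
    (hsum : l.sum = l₀.sum)
    (hlen : l.length = l₀.length ∨ (l.length < l₀.length ∧ 1 < lam * (2 * e + 1)) ∨
      (l₀.length < l.length ∧ lam * (2 * e + 1) < 1)) :
    (l₀.map (response lam)).sum ≤ (l.map (response lam)).sum ∧
      ((l.map (response lam)).sum = (l₀.map (response lam)).sum → l.Perm l₀) := by
  obtain ⟨α, β, h1, h2, h3, h4⟩ := exists_chord h0 hlam he
  have hl₀r : ∀ k ∈ l₀, k ≤ r := fun k hk => by rcases hl₀ k hk with h | h <;> omega
  have e0 := sum_eq_of_affine (g := response lam) (α := α) (β := β) (l := l₀)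
    fun k hk => (h2 k (hl₀r k hk)).2 (hl₀ k hk)
  obtain ⟨e1, e2⟩ := supporting_line_le_sum (g := response lam) (α := α) (β := β) (l := l)
    (P := fun k => k = e ∨ k = e + 1) (fun k hk => h1 k (hl k hk))
    fun k hk => (h2 k (hl k hk)).1
  rw [hsum] at e1 e2
  rw [e0]
  rcases hlen with hlen | ⟨hlen, hα⟩ | ⟨hlen, hα⟩
  · rw [hlen] at e1 e2
    exact ⟨e1, fun h => perm_of_mem_pair (e2 h) hl₀ hlen hsum⟩
  · have : (l.length : ℝ) < l₀.length := by exact_mod_cast hlen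
    have := mul_lt_mul_of_neg_left this (h4 hα)
    exact ⟨by linarith, fun h => absurd h (by linarith)⟩
  · have : (l₀.length : ℝ) < l.length := by exact_mod_cast hlen
    have := mul_lt_mul_of_pos_left this (h3 hα)
    exact ⟨by linarith, fun h => absurd h (by linarith)⟩

/-- If M ≥ s, then M < (q+1)s; with c = s + d this gives qd + t < s, hence c + t ≤ 2s - 1 ≤ r. If M
< s, there is one part, M itself. -/
theorem lower_parts_bounds {M q c t : ℕ} (hs0 : 1 ≤ s) (hs2 : 2 * s ≤ r + 1) (hM : 1 ≤ M)
    (hq : q = max 1 (M / s)) (hMq : M = q * c + t) (ht : t < q) :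
    1 ≤ c ∧ c ≤ r ∧ (0 < t → c + 1 ≤ r) := by
  have hlt := Nat.lt_mul_div_succ M (by omega : 0 < s)
  rcases Nat.eq_zero_or_pos (M / s) with hz | hz
  · rw [hz] at hq hlt
    obtain rfl : q = 1 := by simpa using hq
    omega
  · have hq' : q = M / s := by omega
    have hle := Nat.div_mul_le_self M s
    rw [← hq'] at hlt hle hz
    have hsc : s ≤ c := by
      by_contra! h
      have : q * (c + 1) ≤ q * s := Nat.mul_le_mul_left q h
      nlinarith
    obtain ⟨d, rfl⟩ := Nat.exists_eq_add_of_le hsc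
    obtain ⟨p, rfl⟩ : ∃ p, q = p + 1 := ⟨q - 1, by omega⟩
    have hd : d + t + 1 ≤ s := by nlinarith [Nat.zero_le (p * d)]
    omega

theorem upper_parts_bounds {M q c t : ℕ} (hs0 : 1 ≤ s)
    (hq1 : M ≤ q * s) (hq2 : q * s < M + s) (hMq : M = q * c + t) (ht : t < q) :
    1 ≤ c ∧ c ≤ s ∧ (0 < t → c + 1 ≤ s) := by
  refine ⟨?_, ?_, ?_⟩
  · by_contra h
    obtain rfl : c = 0 := by omega
    simp only [mul_zero, zero_add] at hMq
    subst hMq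
    obtain ⟨m, rfl⟩ := Nat.exists_eq_add_of_le ht
    nlinarith [Nat.zero_le (m * s), Nat.mul_le_mul_left M hs0]
  · by_contra! h
    have : q * (s + 1) ≤ q * c := Nat.mul_le_mul_left q h
    nlinarith
  · intro ht0
    by_contra! h
    have : q * s ≤ q * c := Nat.mul_le_mul_left q (by omega)
    omega

/-- The optimal path lengths. -/
theorem sum_response_optimal (h0 : 0 < lam) (hlam : lam * r < 1) (hlam' : 1 < lam * (r + 1))
    (hs0 : 1 ≤ s) (hs1 : r ≤ 2 * s) (hs2 : 2 * s ≤ r + 1) (hsr : s ≤ r)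
    {M q c t q' c' t' : ℕ} (hM : 1 ≤ M)
    (hq : q = max 1 (M / s)) (hMq : M = q * c + t) (ht : t < q)
    (hq1 : M ≤ q' * s) (hq2 : q' * s < M + s) (hMq' : M = q' * c' + t') (ht' : t' < q')
    {l : List ℕ} (hl : ∀ k ∈ l, 1 ≤ k ∧ k ≤ r) (hsum : l.sum = M) :
    (((balancedParts q c t).map (response lam)).sum ≤ (l.map (response lam)).sum ∧
      ((l.map (response lam)).sum = ((balancedParts q c t).map (response lam)).sum →
        l.Perm (balancedParts q c t))) ∨
    (((balancedParts q' c' t').map (response lam)).sum ≤ (l.map (response lam)).sum ∧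
      ((l.map (response lam)).sum = ((balancedParts q' c' t').map (response lam)).sum →
        l.Perm (balancedParts q' c' t'))) := by
  have hsum' : l.sum = (balancedParts q' c' t').sum := by
    rw [balancedParts_sum ht', hsum, hMq']
  have hsum'' : l.sum = (balancedParts q c t).sum := by
    rw [balancedParts_sum ht, hsum, hMq]
  have hlr : ∀ k ∈ l, k ≤ r := fun k hk => (hl k hk).2
  obtain ⟨b1, b2, b3⟩ := upper_parts_bounds hs0 hq1 hq2 hMq' ht'
  obtain ⟨a1, a2, a3⟩ := lower_parts_bounds hs0 hs2 hM hq hMq ht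
  -- If s divides M, the upper partition consists of parts s only and the ray through s settles
  -- every length.
  rcases hq1.eq_or_lt with hdvd | hlt
  · right
    obtain ⟨rfl, rfl⟩ : c' = s ∧ t' = 0 := by
      have hc : c' = s := by
        by_contra hne
        have : q' * (c' + 1) ≤ q' * s := Nat.mul_le_mul_left q' (by omega)
        nlinarith
      subst hc
      omega
    have hb : ∀ k ∈ balancedParts q' c' 0, k = c' := fun k hk => by
      have := mem_balancedParts hk
      omega
    have hs0' : (c' : ℝ) ≠ 0 := by exact_mod_cast (by omega : c' ≠ 0)
    have e0 := sum_eq_of_affine (g := response lam) (α := 0) (β := response lam c' / c')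
      (l := balancedParts q' c' 0) fun k hk => by
        rw [hb k hk]
        field_simp
        ring
    obtain ⟨e1, e2⟩ := supporting_line_le_sum (g := response lam) (α := 0)
      (β := response lam c' / c') (l := l) (P := fun k => k = c')
      (fun k hk => by
        rw [zero_add]
        exact (response_ge_ray h0 hlam hlam' hs0 hs1 hs2 hsr (hl k hk).2).1)
      fun k hk h => by
        rw [zero_add] at h
        exact (response_ge_ray h0 hlam hlam' hs0 hs1 hs2 hsr (hl k hk).2).2 h
    rw [zero_mul, zero_add] at e0 e1 e2
    rw [hsum'] at e1 e2
    rw [e0]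
    refine ⟨e1, fun h => ?_⟩
    have hlc := e2 h
    have h3 : l = List.replicate l.length c' := List.eq_replicate_of_mem hlc
    have h4 : l.length * c' = q' * c' := by
      have := hsum
      rw [h3, List.sum_replicate, smul_eq_mul] at this
      rw [this, hdvd]
    have h5 : l.length = q' := Nat.eq_of_mul_eq_mul_right hs0 h4
    rw [h3, h5]
    simp [balancedParts]
  · have hc's : c' + 1 ≤ s := by
      by_contra! h
      have : q' * s ≤ q' * c' := Nat.mul_le_mul_left q' (by omega)
      omega
    -- With fewer than q' parts, compare with the lower partition: its parts are at least s, the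
    -- chord has negative intercept, and still fewer parts cost more.
    rcases Nat.lt_or_ge l.length q' with hlen | hlen
    · left
      have hq0 : q = M / s := by
        rcases Nat.eq_zero_or_pos (M / s) with hz | hz
        · exfalso
          have hMs : M < s := (Nat.div_eq_zero_iff.1 hz).resolve_left (by omega)
          have h1 : q' ≤ 1 := by
            by_contra! h
            have : 2 * s ≤ q' * s := Nat.mul_le_mul_right s h
            omega
          have h2 : l = [] := by
            rw [← List.length_eq_zero_iff]
            omega
          rw [h2] at hsum
          simp at hsum
          omega
        · omega
      have hle := Nat.div_mul_le_self M s
      have hlts := Nat.lt_mul_div_succ M (by omega : 0 < s)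
      rw [← hq0] at hle hlts
      have hq' : q' ≤ q + 1 := by
        by_contra! h
        have : (q + 2) * s ≤ q' * s := Nat.mul_le_mul_right s h
        nlinarith
      have hne : M ≠ q * s := by
        intro h
        have h1 : q < q' := by
          by_contra! h'
          have := Nat.mul_le_mul_right s h'
          omega
        have : (q + 1) * s ≤ q' * s := Nat.mul_le_mul_right s h1
        nlinarith
      have hcs : s ≤ c := by
        by_contra! h
        have : q * (c + 1) ≤ q * s := Nat.mul_le_mul_left q h
        nlinarith
      have hslope : ∀ e : ℕ, s ≤ e → 1 < lam * (2 * e + 1) := by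
        intro e he
        have : (r : ℝ) ≤ 2 * e := by exact_mod_cast (by omega : r ≤ 2 * e)
        nlinarith
      have hlen' : l.length = q ∨ l.length < q := by omega
      rw [← balancedParts_length (c := c) ht] at hlen'
      rcases Nat.eq_zero_or_pos t with rfl | htpos
      -- When t = 0 the chord over [c-1, c] is used, because c + 1 might exceed r; c > s keeps its
      -- intercept negative.
      · have hsc : s < c := by
          refine lt_of_le_of_ne hcs ?_
          rintro rfl
          exact hne (by omega)
        refine sum_response_le_of_chord h0 hlam (e := c - 1) (by omega) hlr (fun k hk => ?_)
          hsum'' (hlen'.imp_right fun h => Or.inl ⟨h, hslope _ (by omega)⟩)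
        have := mem_balancedParts hk
        omega
      · refine sum_response_le_of_chord h0 hlam (a3 htpos) hlr (fun k hk => ?_)
          hsum'' (hlen'.imp_right fun h => Or.inl ⟨h, hslope _ hcs⟩)
        have := mem_balancedParts hk
        omega
    -- With at least q' parts, 2c' + 1 ≤ r makes the intercept positive, so parts beyond q' cost
    -- more.
    · right
      have hlen' : l.length = q' ∨ q' < l.length := by omega
      rw [← balancedParts_length (c := c') ht'] at hlen'
      refine sum_response_le_of_chord h0 hlam (by omega : c' + 1 ≤ r) hlr (fun k hk => ?_)
        hsum' (hlen'.imp_right fun h => Or.inr ⟨h, ?_⟩)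
      · have := mem_balancedParts hk
        omega
      · have : 2 * (c' : ℝ) + 1 ≤ r := by exact_mod_cast (by omega : 2 * c' + 1 ≤ r)
        nlinarith

end Optimisation

/-! ### From the secular function to the two candidates. -/

section Extremal

open BicentralForest

/-- The function of `lam` whose value `1` characterises `λ₂` of the spider with branches of lengths
`r + 1`, `r` and the entries of `L`. -/
noncomputable def secular (lam : ℝ) (r : ℕ) (L : List ℕ) : ℝ :=
  (response lam r - 1) * (response lam r - 1 + (L.map (response lam)).sum)

variable {r : ℕ}

theorem one_lt_response {lam : ℝ} (hlam : lam * r < 1) (hlam' : 1 < lam * (r + 1)) :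
    1 < response lam r := by
  have : 0 < 1 - lam * r := by linarith
  rw [response, one_lt_div this]
  linarith

theorem pos_of_one_lt_mul {lam : ℝ} (hlam' : 1 < lam * (r + 1)) : 0 < lam := by
  have : (0 : ℝ) < r + 1 := by positivity
  by_contra h
  nlinarith

theorem response_nonneg {lam : ℝ} (h0 : 0 < lam) (hlam : lam * r < 1) {k : ℕ} (hk : k ≤ r) :
    0 ≤ response lam k :=
  (div_pos h0 (one_sub_mul_pos h0 hlam hk)).le

theorem sum_response_nonneg {lam : ℝ} (h0 : 0 < lam) (hlam : lam * r < 1) {L : List ℕ}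
    (hL : ∀ k ∈ L, k ≤ r) : 0 ≤ (L.map (response lam)).sum := by
  refine List.sum_nonneg fun y hy => ?_
  obtain ⟨k, hk, rfl⟩ := List.mem_map.1 hy
  exact response_nonneg h0 hlam (hL k hk)

theorem response_mono {lam mu : ℝ} (h0 : 0 < lam) (hle : lam ≤ mu) (hmu : mu * r < 1) {k : ℕ}
    (hk : k ≤ r) : response lam k ≤ response mu k := by
  have h1 := one_sub_mul_pos (h0.trans_le hle) hmu hk
  have h2 : (0 : ℝ) ≤ k := by positivity
  have h3 : 0 < 1 - lam * k := by nlinarith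
  rw [response, response, div_le_div_iff₀ h3 h1]
  nlinarith

theorem secular_mono {lam mu : ℝ} (hlam : 1 < lam * (r + 1)) (hle : lam ≤ mu) (hmu : mu * r < 1)
    {L : List ℕ} (hL : ∀ k ∈ L, k ≤ r) : secular lam r L ≤ secular mu r L := by
  have h0 := pos_of_one_lt_mul hlam
  have hr0 : (0 : ℝ) ≤ r := by positivity
  have hlr : lam * r < 1 := (mul_le_mul_of_nonneg_right hle hr0).trans_lt hmu
  have h1 := one_lt_response hlr hlam
  have h2 := response_mono h0 hle hmu (le_refl r)
  have h3 : (L.map (response lam)).sum ≤ (L.map (response mu)).sum :=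
    List.sum_le_sum fun k hk => response_mono h0 hle hmu (hL k hk)
  have h4 := sum_response_nonneg h0 hlr hL
  exact mul_le_mul (by linarith) (by linarith) (by linarith) (by linarith)

/-- A crude bound linear in the total, from y(1-y) ≤ 1 with y = lam k; it serves to bound the order.
-/
theorem mul_sum_le_sum_response {lam : ℝ} (h0 : 0 < lam) (hlam : lam * r < 1) {L : List ℕ}
    (hL : ∀ k ∈ L, k ≤ r) : lam ^ 2 * (L.sum : ℕ) ≤ (L.map (response lam)).sum := by
  have h := (supporting_line_le_sum (g := response lam) (α := 0) (β := lam ^ 2) (l := L)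
    (P := fun _ => True) (fun k hk => ?_) fun _ _ _ => trivial).1
  · linarith
  · have h1 := one_sub_mul_pos h0 hlam (hL k hk)
    rw [response, le_div_iff₀ h1]
    have h2 : (lam * k) * (1 - lam * k) ≤ 1 := by nlinarith [sq_nonneg (lam * k - 1 / 2)]
    nlinarith

/-- The list of excess path lengths of a tree of diameter `2 * r + 1`, and the bound for `λ₂` it
provides. -/
theorem exists_excess_lengths {V : Type*} [Fintype V] {G : SimpleGraph V} (hr : 1 ≤ r) {M : ℕ}
    (hG : IsTreeOfOrderDiam (2 * r + 2 + M) (2 * r + 1) G) :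
    2 ≤ (leaves G).card ∧ ∃ L : List ℕ, (∀ k ∈ L, 1 ≤ k ∧ k ≤ r) ∧ L.sum = M ∧
      (L = [] → Nonempty (G ≃g spider [r + 1, r])) ∧
      ∀ lam : ℝ, lam * r < 1 → 1 < lam * (r + 1) → 1 ≤ secular lam r L →
        steklovLambda2 G ≤ lam ∧ (steklovLambda2 G = lam → secular lam r L = 1 ∧
          ∀ L', L.Perm L' → Nonempty (G ≃g spider ((r + 1) :: r :: L'))) := by
  obtain ⟨htree, hcard, hdiam⟩ := hG
  obtain ⟨B⟩ := exists_bicentralForest htree hdiam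
  refine ⟨B.two_le_card_leaves hr, B.tops.toList.map fun v => B.H v + 1, ?_, ?_, ?_, ?_⟩
  · intro k hk
    obtain ⟨v, hv, rfl⟩ := List.mem_map.1 hk
    have := B.tops_spec (Finset.mem_toList.1 hv)
    exact ⟨by omega, B.H_add_one_le this.1 this.2.1⟩
  · rw [Finset.sum_map_toList]
    have := B.card_eq
    omega
  · intro h
    refine B.iso_spider_of_tops htree hr (fun v hv => ?_) (by rw [h])
    have : v ∈ B.tops.toList := Finset.mem_toList.2 hv
    rw [List.map_eq_nil_iff] at h
    rw [h] at this
    simp at this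
  · intro lam hlam hlam' hΦ
    have hsum : ((B.tops.toList.map fun v => B.H v + 1).map (response lam)).sum =
        ∑ v ∈ B.tops, response lam (B.H v + 1) := by
      rw [List.map_map, ← Finset.sum_map_toList]
      rfl
    rw [secular, hsum] at hΦ ⊢
    obtain ⟨h1, h2⟩ := B.steklovLambda2_le htree.connected hr hlam hlam' hΦ
    refine ⟨h1, fun h => ?_⟩
    obtain ⟨h3 | h3, h4⟩ := h2 h
    · refine ⟨h4, fun L' hL' => B.swap.iso_spider_of_tops htree hr ?_ ?_⟩
      · rw [B.swap_tops]; exact h3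
      · rw [B.swap_tops]; exact hL'
    · exact ⟨h4, fun L' hL' => B.iso_spider_of_tops htree hr h3 hL'⟩

/-- The value of `λ₂` for almost seesaw spiders. -/
theorem steklovLambda2_spider (hr : 1 ≤ r) {L : List ℕ} (hL : ∀ k ∈ L, 1 ≤ k ∧ k ≤ r) :
    steklovLambda2 (spider ((r + 1) :: r :: L)) * r < 1 ∧
      1 < steklovLambda2 (spider ((r + 1) :: r :: L)) * (r + 1) ∧
      secular (steklovLambda2 (spider ((r + 1) :: r :: L))) r L = 1 := by
  have htree := spider_isTreeOfOrderDiam hr fun k hk => (hL k hk).2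
  obtain ⟨hleaf, L', hL', -, -, hbound⟩ := exists_excess_lengths hr htree
  obtain ⟨hpos, hev, -⟩ := steklovLambda2_spec htree.1.connected hleaf
  have hr0 : (0 : ℝ) < r := by exact_mod_cast hr
  -- At this trial value the response of r is 2, so the secular function is at least 1 for every
  -- list; this places `λ₂` below 1/r.
  have hmu : (2 / (2 * r + 1) : ℝ) * r < 1 := by
    rw [div_mul_eq_mul_div, div_lt_one (by positivity)]
    linarith
  have hmu' : 1 < (2 / (2 * r + 1) : ℝ) * (r + 1) := by
    rw [div_mul_eq_mul_div, one_lt_div (by positivity)]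
    linarith
  have hres : response (2 / (2 * r + 1)) r = 2 := by
    have h1 : (2 * r + 1 : ℝ) ≠ 0 := by positivity
    have h2 : 1 - 2 / (2 * r + 1) * (r : ℝ) = 1 / (2 * r + 1) := by
      field_simp
      ring
    rw [response, h2]
    field_simp
  have hS := sum_response_nonneg (pos_of_one_lt_mul hmu') hmu fun k hk => (hL' k hk).2
  have hle := (hbound _ hmu hmu' (by rw [secular, hres]; linarith)).1
  have hlt : steklovLambda2 (spider ((r + 1) :: r :: L)) * r < 1 :=
    (mul_le_mul_of_nonneg_right hle hr0.le).trans_lt hmu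
  exact ⟨hlt, spider_secular hr hL hpos hlt hev⟩

theorem mem_balancedParts_bounds {q c t : ℕ} (h : 1 ≤ c ∧ c ≤ r ∧ (0 < t → c + 1 ≤ r)) :
    ∀ k ∈ balancedParts q c t, 1 ≤ k ∧ k ≤ r := by
  intro k hk
  have := mem_balancedParts hk
  omega

variable {s M q c t q' c' t' : ℕ}

/-- The two almost seesaw spiders dominate all trees of the same order and diameter. -/
theorem steklovLambda2_le_max (hr : 1 ≤ r)
    (hs0 : 1 ≤ s) (hs1 : r ≤ 2 * s) (hs2 : 2 * s ≤ r + 1) (hM : 1 ≤ M)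
    (hq : q = max 1 (M / s)) (hMq : M = q * c + t) (ht : t < q)
    (hq1 : M ≤ q' * s) (hq2 : q' * s < M + s) (hMq' : M = q' * c' + t') (ht' : t' < q')
    {V : Type*} [Fintype V] {G : SimpleGraph V}
    (hG : IsTreeOfOrderDiam (2 * r + 2 + M) (2 * r + 1) G) :
    steklovLambda2 G ≤ max (steklovLambda2 (almostSeesaw r (q + 2) c t))
        (steklovLambda2 (almostSeesaw r (q' + 2) c' t')) ∧
      (steklovLambda2 G = max (steklovLambda2 (almostSeesaw r (q + 2) c t))
        (steklovLambda2 (almostSeesaw r (q' + 2) c' t')) →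
        Nonempty (G ≃g almostSeesaw r (q + 2) c t) ∨
        Nonempty (G ≃g almostSeesaw r (q' + 2) c' t')) := by
  have hsr : s ≤ r := by omega
  have hb := mem_balancedParts_bounds (q := q) (lower_parts_bounds hs0 hs2 hM hq hMq ht)
  have hb' : ∀ k ∈ balancedParts q' c' t', 1 ≤ k ∧ k ≤ r := by
    obtain ⟨h1, h2, h3⟩ := upper_parts_bounds hs0 hq1 hq2 hMq' ht'
    exact mem_balancedParts_bounds ⟨h1, by omega, fun h => by have := h3 h; omega⟩
  obtain ⟨m1, m2, m3⟩ := steklovLambda2_spider hr hb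
  obtain ⟨p1, p2, p3⟩ := steklovLambda2_spider hr hb'
  change steklovLambda2 G ≤ max (steklovLambda2 (spider ((r + 1) :: r :: balancedParts q c t)))
    (steklovLambda2 (spider ((r + 1) :: r :: balancedParts q' c' t'))) ∧ (steklovLambda2 G =
    max (steklovLambda2 (spider ((r + 1) :: r :: balancedParts q c t)))
      (steklovLambda2 (spider ((r + 1) :: r :: balancedParts q' c' t'))) →
    Nonempty (G ≃g spider ((r + 1) :: r :: balancedParts q c t)) ∨
    Nonempty (G ≃g spider ((r + 1) :: r :: balancedParts q' c' t')))
  set lm := steklovLambda2 (spider ((r + 1) :: r :: balancedParts q c t))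
  set lp := steklovLambda2 (spider ((r + 1) :: r :: balancedParts q' c' t'))
  -- Both candidates have secular value 1 at their own `λ₂`, hence at least 1 at mu by monotonicity.
  -- A list with larger total response inherits this, and the upper bound applies at mu.
  set mu := max lm lp with hmu
  have hmu1 : mu * r < 1 := by rcases max_choice lm lp with h | h <;> rw [hmu, h] <;> assumption
  have hmu2 : 1 < mu * (r + 1) := by
    rcases max_choice lm lp with h | h <;> rw [hmu, h] <;> assumption
  have hmu0 := pos_of_one_lt_mul hmu2
  have e1 := secular_mono m2 (le_max_left lm lp) hmu1 fun k hk => (hb k hk).2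
  have e2 := secular_mono p2 (le_max_right lm lp) hmu1 fun k hk => (hb' k hk).2
  rw [m3] at e1
  rw [p3] at e2
  obtain ⟨-, L, hL, hLM, -, hbound⟩ := exists_excess_lengths hr hG
  have hq0 : 0 < response mu r - 1 := by linarith [one_lt_response hmu1 hmu2]
  have key : ∀ L₀ : List ℕ, 1 ≤ secular mu r L₀ →
      (L₀.map (response mu)).sum ≤ (L.map (response mu)).sum →
      ((L.map (response mu)).sum = (L₀.map (response mu)).sum → L.Perm L₀) →
      steklovLambda2 G ≤ mu ∧ (steklovLambda2 G = mu →
        Nonempty (G ≃g spider ((r + 1) :: r :: L₀))) := by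
    intro L₀ h1 h2 h3
    have h4 : secular mu r L₀ ≤ secular mu r L :=
      mul_le_mul_of_nonneg_left (by linarith) hq0.le
    obtain ⟨h5, h6⟩ := hbound mu hmu1 hmu2 (h1.trans h4)
    refine ⟨h5, fun h => ?_⟩
    obtain ⟨h7, h8⟩ := h6 h
    refine h8 _ (h3 ?_)
    have h9 : secular mu r L = secular mu r L₀ := by linarith
    have := mul_left_cancel₀ hq0.ne' h9
    linarith
  rcases sum_response_optimal hmu0 hmu1 hmu2 hs0 hs1 hs2 hsr hM hq hMq ht hq1 hq2 hMq' ht' hL hLM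
    with ⟨h1, h2⟩ | ⟨h1, h2⟩
  · have := key _ e1 h1 h2
    exact ⟨this.1, fun h => Or.inl (this.2 h)⟩
  · have := key _ e2 h1 h2
    exact ⟨this.1, fun h => Or.inr (this.2 h)⟩

theorem pathGraph_isTreeOfOrderDiam (k : ℕ) :
    IsTreeOfOrderDiam (k + 1) k (SimpleGraph.pathGraph (k + 1)) := by
  have hconn := SimpleGraph.pathGraph_connected k
  have hadj : ∀ x y : Fin (k + 1), (SimpleGraph.pathGraph (k + 1)).Adj x y ↔
      (x : ℕ) + 1 = y ∨ (y : ℕ) + 1 = x := fun x y => SimpleGraph.pathGraph_adj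
  refine ⟨hconn.isTree_of_parent 0 (fun x => ⟨(x : ℕ) - 1, by omega⟩) fun x y h => ?_,
    Fintype.card_fin _, le_antisymm ?_ ?_⟩
  · rcases (hadj x y).1 h with h | h
    · refine Or.inr ⟨fun h0 => ?_, Fin.ext (by simp only; omega)⟩
      rw [h0] at h
      simp at h
    · refine Or.inl ⟨fun h0 => ?_, Fin.ext (by simp only; omega)⟩
      rw [h0] at h
      simp at h
  · obtain ⟨x, y, hxy⟩ := (SimpleGraph.pathGraph (k + 1)).exists_dist_eq_diam
    obtain ⟨p, hp, hlen⟩ := hconn.exists_path_of_dist x y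
    have := hp.length_lt
    rw [Fintype.card_fin] at this
    omega
  · have h := abs_sub_le_mul_dist (f := fun x : Fin (k + 1) => ((x : ℕ) : ℝ)) (C := 1) hconn
      (fun x y h => ?_) (Fin.last k) 0
    · have h2 := SimpleGraph.dist_le_diam (SimpleGraph.connected_iff_ediam_ne_top.1 hconn)
        (u := Fin.last k) (v := 0)
      have h3 := (le_abs_self _).trans h
      simp only [Fin.val_last, Fin.val_zero, Nat.cast_zero, sub_zero, one_mul] at h3
      exact (Nat.cast_le.1 h3).trans h2
    · rcases (hadj x y).1 h with h | h <;> rw [← h] <;> push_cast <;> simp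

theorem IsUniqueExtremizer.of_iso {V W : Type} [Fintype V] [Fintype W] {G : SimpleGraph V}
    {H : SimpleGraph W} {n D : ℕ} (e : G ≃g H) (h : IsUniqueExtremizer n D H) :
    IsUniqueExtremizer n D G := by
  obtain ⟨⟨h1, h2⟩, h3⟩ := h
  refine ⟨⟨h1.of_iso e, fun U _ K hK => ?_⟩, fun U _ K hK => ?_⟩
  · rw [steklovLambda2_iso e]
    exact h2 U K hK
  · obtain ⟨e'⟩ := h3 U K hK
    exact ⟨e'.trans e.symm⟩

/-- With no excess vertices the list of path lengths is empty, so there is only one such tree. -/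
theorem path_isUniqueExtremizer (hr : 1 ≤ r) :
    IsUniqueExtremizer (2 * r + 2) (2 * r + 1) (SimpleGraph.pathGraph (2 * r + 2)) := by
  have hpath := pathGraph_isTreeOfOrderDiam (2 * r + 1)
  have hiso : ∀ {W : Type} [Fintype W] {H : SimpleGraph W},
      IsTreeOfOrderDiam (2 * r + 2) (2 * r + 1) H → Nonempty (H ≃g spider [r + 1, r]) := by
    intro W _ H hH
    obtain ⟨-, L, hL, hsum, hnil, -⟩ := exists_excess_lengths (M := 0) hr hH
    refine hnil (List.eq_nil_iff_forall_not_mem.2 fun k hk => ?_)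
    have := List.sum_eq_zero_iff.1 hsum k hk
    have := hL k hk
    omega
  obtain ⟨e⟩ := hiso hpath
  refine ⟨⟨hpath, fun W _ H hH => ?_⟩, fun W _ H hH => ?_⟩
  · obtain ⟨e'⟩ := hiso hH
    rw [steklovLambda2_iso e, steklovLambda2_iso e']
  · obtain ⟨e'⟩ := hiso hH.1
    exact ⟨e'.trans e.symm⟩

end Extremal

/-! ### Excluding ties for large orders. -/

section LargeOrder

variable {r s M q t : ℕ}

/-- Multiplied out, the equality of the secular functions of the two almost seesaw spiders is a
quadratic equation that does not depend on the order. -/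
theorem quadratic_eq_zero_of_sum_eq {lam : ℝ} (h0 : 0 < lam) (hlam : lam * r < 1) (hs : s + 1 ≤ r)
    (hs0 : 1 ≤ s) (hts : t < s) (hsq : s ≤ q)
    (h : ((balancedParts q s t).map (response lam)).sum =
      ((balancedParts (q + 1) (s - 1) (q + 1 - (s - t))).map (response lam)).sum) :
    -1 + 3 * s * lam - (2 * s ^ 2 + s - 1 - 2 * t) * lam ^ 2 = 0 := by
  obtain ⟨a, rfl⟩ : ∃ a, s = a + 1 := ⟨s - 1, by omega⟩
  obtain ⟨b, hb⟩ := Nat.exists_eq_add_of_le (by omega : t ≤ a + 1)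
  obtain ⟨m, rfl⟩ := Nat.exists_eq_add_of_le hsq
  have e1 : a + 1 + m + 1 - b = m + 1 + t := by omega
  have e2 : a + 1 + m + 1 - (m + 1 + t) = b := by omega
  have e3 : a + 1 + m - t = b + m := by omega
  have e4 : a + 1 - t = b := by omega
  -- The numbers of parts equal to s in the two lists differ by 2t + 1 - s, so q drops out of the
  -- equation.
  simp only [balancedParts, e1, e2, e3, e4, List.map_append, List.map_replicate, List.sum_append,
    List.sum_replicate, nsmul_eq_mul, Nat.add_sub_cancel] at h
  have p1 := one_sub_mul_pos h0 hlam (by omega : a ≤ r)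
  have p2 := one_sub_mul_pos h0 hlam (by omega : a + 1 ≤ r)
  have p3 := one_sub_mul_pos h0 hlam hs
  have r1 : response lam a * (1 - lam * a) = lam := div_mul_cancel₀ _ p1.ne'
  have r2 : response lam (a + 1) * (1 - lam * (a + 1 : ℕ)) = lam := div_mul_cancel₀ _ p2.ne'
  have r3 : response lam (a + 1 + 1) * (1 - lam * (a + 1 + 1 : ℕ)) = lam :=
    div_mul_cancel₀ _ p3.ne'
  have hb' : (b : ℝ) = a + 1 - t := eq_sub_of_add_eq' (by exact_mod_cast hb.symm)
  push_cast at h r1 r2 r3 ⊢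
  rw [hb'] at h
  have hmain : lam * (-1 + 3 * ((a : ℝ) + 1) * lam -
      (2 * ((a : ℝ) + 1) ^ 2 + (a + 1) - 1 - 2 * t) * lam ^ 2) = 0 := by
    linear_combination (1 - lam * a) * (1 - lam * (a + 1)) * (1 - lam * (a + 1 + 1)) * h
      - t * (1 - lam * a) * (1 - lam * (a + 1)) * r3
      + (2 * t - a) * (1 - lam * a) * (1 - lam * (a + 1 + 1)) * r2
      + ((a : ℝ) + 1 - t) * (1 - lam * (a + 1)) * (1 - lam * (a + 1 + 1)) * r1
  exact (mul_eq_zero.1 hmain).resolve_left h0.ne'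

/-- The constant term -1 keeps the polynomial nonzero even if b and c vanish. -/
theorem finite_quadratic_roots (b c : ℝ) : {x : ℝ | -1 + b * x - c * x ^ 2 = 0}.Finite := by
  let P : Polynomial ℝ := Polynomial.C (-1) + Polynomial.C b * Polynomial.X -
    Polynomial.C c * Polynomial.X ^ 2
  have hP : P ≠ 0 := by
    intro h
    have := congrArg (Polynomial.eval 0) h
    simp [P] at this
  refine (P.roots.toFinset.finite_toSet).subset fun x hx => ?_
  rw [Finset.mem_coe, Multiset.mem_toFinset, Polynomial.mem_roots hP, Polynomial.IsRoot]
  simpa [P] using hx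

/-- A given value of `λ₂` occurs only for bounded M. -/
theorem mul_le_one_of_secular {lam : ℝ} (hlam : lam * r < 1) (hlam' : 1 < lam * (r + 1))
    {L : List ℕ} (hL : ∀ k ∈ L, k ≤ r) (h : secular lam r L = 1) :
    (L.sum : ℕ) ≤ 1 / ((response lam r - 1) * lam ^ 2) := by
  have h0 := pos_of_one_lt_mul hlam'
  have h1 := one_lt_response hlam hlam'
  have h2 := mul_sum_le_sum_response h0 hlam hL
  have hq : 0 < response lam r - 1 := by linarith
  rw [le_div_iff₀ (by positivity)]
  rw [secular] at h
  have := mul_le_mul_of_nonneg_left h2 hq.le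
  nlinarith [mul_pos hq hq]

/-- For large orders the two candidates either coincide or have different `λ₂`. -/
theorem exists_forall_steklovLambda2_ne (hr : 1 ≤ r) (hs0 : 1 ≤ s) (hs2 : 2 * s ≤ r + 1) :
    ∃ N : ℕ, ∀ q t : ℕ, s ≤ q → 0 < t → t < s → N ≤ q * s + t →
      steklovLambda2 (almostSeesaw r (q + 2) s t) ≠
        steklovLambda2 (almostSeesaw r (q + 1 + 2) (s - 1) (q + 1 - (s - t))) := by
  have hfin : (⋃ t ∈ Finset.range s, {x : ℝ | -1 + (3 * s : ℝ) * x -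
      (2 * (s : ℝ) ^ 2 + s - 1 - 2 * t) * x ^ 2 = 0}).Finite :=
    Set.Finite.biUnion (Finset.finite_toSet _) fun t _ => finite_quadratic_roots _ _
  -- Tie values lie in a finite set, so a single bound on M serves them all.
  obtain ⟨K, hK⟩ := (hfin.image fun x => 1 / ((response x r - 1) * x ^ 2)).bddAbove
  obtain ⟨N, hN⟩ := exists_nat_gt K
  refine ⟨N, fun q t hsq ht hts hNq heq => ?_⟩
  have hsr : s + 1 ≤ r := by omega
  have hb : ∀ k ∈ balancedParts q s t, 1 ≤ k ∧ k ≤ r :=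
    mem_balancedParts_bounds ⟨hs0, by omega, fun _ => hsr⟩
  have hb' : ∀ k ∈ balancedParts (q + 1) (s - 1) (q + 1 - (s - t)), 1 ≤ k ∧ k ≤ r :=
    mem_balancedParts_bounds ⟨by omega, by omega, fun _ => by omega⟩
  obtain ⟨m1, m2, m3⟩ := steklovLambda2_spider hr hb
  obtain ⟨p1, p2, p3⟩ := steklovLambda2_spider hr hb'
  change steklovLambda2 (spider ((r + 1) :: r :: balancedParts q s t)) = steklovLambda2
    (spider ((r + 1) :: r :: balancedParts (q + 1) (s - 1) (q + 1 - (s - t)))) at heq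
  rw [← heq] at p3
  set lam := steklovLambda2 (spider ((r + 1) :: r :: balancedParts q s t))
  have hq0 : response lam r - 1 ≠ 0 := by linarith [one_lt_response m1 m2]
  have hsum := mul_left_cancel₀ hq0 (m3.trans p3.symm)
  have hroot := quadratic_eq_zero_of_sum_eq (pos_of_one_lt_mul m2) m1 hsr hs0 hts hsq
    (add_left_cancel hsum)
  have hbound := mul_le_one_of_secular m1 m2 (fun k hk => (hb k hk).2) m3
  rw [balancedParts_sum (by omega)] at hbound
  have hle := hK (Set.mem_image_of_mem _ (Set.mem_biUnion
    (Finset.mem_coe.2 (Finset.mem_range.2 hts)) hroot))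
  have : (N : ℝ) ≤ (q * s + t : ℕ) := by exact_mod_cast hNq
  linarith

end LargeOrder

/-! ### Assembling the theorem. -/

section Main

variable {r s M q c t q' c' t' : ℕ}

theorem almostSeesaw_isTreeOfOrderDiam (hr : 1 ≤ r) (h : 1 ≤ c ∧ c ≤ r ∧ (0 < t → c + 1 ≤ r))
    (ht : t < q) (hM : M = q * c + t) :
    IsTreeOfOrderDiam (2 * r + 2 + M) (2 * r + 1) (almostSeesaw r (q + 2) c t) := by
  have := spider_isTreeOfOrderDiam hr fun k hk => (mem_balancedParts_bounds (q := q) h k hk).2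
  rwa [balancedParts_sum ht, ← hM] at this

theorem almostSeesaw_extremal (hr : 1 ≤ r)
    (hs0 : 1 ≤ s) (hs1 : r ≤ 2 * s) (hs2 : 2 * s ≤ r + 1) (hM : 1 ≤ M)
    (hq : q = max 1 (M / s)) (hMq : M = q * c + t) (ht : t < q)
    (hq1 : M ≤ q' * s) (hq2 : q' * s < M + s) (hMq' : M = q' * c' + t') (ht' : t' < q') :
    IsGreatest
      {x : ℝ | ∃ (V : Type) (_ : Fintype V) (G : SimpleGraph V),
        IsTreeOfOrderDiam (2 * r + 2 + M) (2 * r + 1) G ∧ steklovLambda2 G = x}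
      (max (steklovLambda2 (almostSeesaw r (q + 2) c t))
        (steklovLambda2 (almostSeesaw r (q' + 2) c' t'))) ∧
    IsTreeOfOrderDiam (2 * r + 2 + M) (2 * r + 1) (almostSeesaw r (q + 2) c t) ∧
    IsTreeOfOrderDiam (2 * r + 2 + M) (2 * r + 1) (almostSeesaw r (q' + 2) c' t') ∧
    (∀ (V : Type) [Fintype V] (G : SimpleGraph V), IsExtremizer (2 * r + 2 + M) (2 * r + 1) G →
      Nonempty (G ≃g almostSeesaw r (q + 2) c t) ∨
      Nonempty (G ≃g almostSeesaw r (q' + 2) c' t')) ∧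
    (steklovLambda2 (almostSeesaw r (q' + 2) c' t') <
        steklovLambda2 (almostSeesaw r (q + 2) c t) →
      IsUniqueExtremizer (2 * r + 2 + M) (2 * r + 1) (almostSeesaw r (q + 2) c t)) ∧
    (steklovLambda2 (almostSeesaw r (q + 2) c t) <
        steklovLambda2 (almostSeesaw r (q' + 2) c' t') →
      IsUniqueExtremizer (2 * r + 2 + M) (2 * r + 1) (almostSeesaw r (q' + 2) c' t')) := by
  have hA := almostSeesaw_isTreeOfOrderDiam hr (lower_parts_bounds hs0 hs2 hM hq hMq ht) ht hMq
  have hA' : IsTreeOfOrderDiam (2 * r + 2 + M) (2 * r + 1) (almostSeesaw r (q' + 2) c' t') := by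
    obtain ⟨h1, h2, h3⟩ := upper_parts_bounds hs0 hq1 hq2 hMq' ht'
    exact almostSeesaw_isTreeOfOrderDiam hr ⟨h1, by omega, fun h => by have := h3 h; omega⟩ ht' hMq'
  have hmax : ∀ (V : Type) [Fintype V] (G : SimpleGraph V), _ → _ := fun V _ G hG =>
    steklovLambda2_le_max hr hs0 hs1 hs2 hM hq hMq ht hq1 hq2 hMq' ht' (V := V) (G := G) hG
  set A := almostSeesaw r (q + 2) c t
  set A' := almostSeesaw r (q' + 2) c' t'
  have hext : ∀ (V : Type) [Fintype V] (G : SimpleGraph V),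
      IsExtremizer (2 * r + 2 + M) (2 * r + 1) G →
      steklovLambda2 G = max (steklovLambda2 A) (steklovLambda2 A') := fun V _ G hG =>
    le_antisymm (hmax V G hG.1).1 (max_le (hG.2 _ A hA) (hG.2 _ A' hA'))
  have hext' : ∀ (V : Type) [Fintype V] (G : SimpleGraph V),
      IsExtremizer (2 * r + 2 + M) (2 * r + 1) G → Nonempty (G ≃g A) ∨ Nonempty (G ≃g A') :=
    fun V _ G hG => (hmax V G hG.1).2 (hext V G hG)
  refine ⟨⟨?_, ?_⟩, hA, hA', hext', fun h => ⟨⟨hA, fun W _ H hH => ?_⟩, fun W _ H hH => ?_⟩,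
    fun h => ⟨⟨hA', fun W _ H hH => ?_⟩, fun W _ H hH => ?_⟩⟩
  · rcases max_choice (steklovLambda2 A) (steklovLambda2 A') with h | h
    · exact ⟨_, _, A, hA, h.symm⟩
    · exact ⟨_, _, A', hA', h.symm⟩
  · rintro x ⟨V, _, G, hG, rfl⟩
    exact (hmax V G hG).1
  · have := (hmax W H hH).1
    rwa [max_eq_left h.le] at this
  · refine (hext' W H hH).resolve_right fun ⟨e⟩ => ?_
    have := hext W H hH
    rw [steklovLambda2_iso e, max_eq_left h.le] at this
    exact h.ne this
  · have := (hmax W H hH).1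
    rwa [max_eq_right h.le] at this
  · refine (hext' W H hH).resolve_left fun ⟨e⟩ => ?_
    have := hext W H hH
    rw [steklovLambda2_iso e, max_eq_right h.le] at this
    exact h.ne this

theorem exists_isUniqueExtremizer_fin {V : Type} [Fintype V] {G : SimpleGraph V} {n D : ℕ}
    (h : IsUniqueExtremizer n D G) : ∃ H : SimpleGraph (Fin n), IsUniqueExtremizer n D H := by
  let e := (Fintype.equivFinOfCardEq h.1.1.2.1).symm
  exact ⟨G.comap e, h.of_iso (SimpleGraph.Iso.comap e G)⟩

theorem exists_unique_extremizer_of_large (hr : 1 ≤ r)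
    (hs0 : 1 ≤ s) (hs1 : r ≤ 2 * s) (hs2 : 2 * s ≤ r + 1) :
    ∃ N : ℕ, ∀ M : ℕ, N ≤ M → ∃ H : SimpleGraph (Fin (2 * r + 2 + M)),
      IsUniqueExtremizer (2 * r + 2 + M) (2 * r + 1) H := by
  obtain ⟨N, hN⟩ := exists_forall_steklovLambda2_ne hr hs0 hs2
  -- M ≥ s² gives q ≥ s, so M = qs + t also splits into q + 1 parts of sizes s and s - 1.
  refine ⟨max N (s * s), fun M hM => ?_⟩
  have hMN : N ≤ M := (le_max_left _ _).trans hM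
  have hMs : s * s ≤ M := (le_max_right _ _).trans hM
  have hM1 : 1 ≤ M := (Nat.mul_le_mul hs0 hs0).trans hMs
  obtain ⟨q, hqM⟩ : ∃ q, q = M / s := ⟨_, rfl⟩
  obtain ⟨t, htM⟩ : ∃ t, t = M % s := ⟨_, rfl⟩
  have hsq : s ≤ q := hqM ▸ (Nat.le_div_iff_mul_le (by omega)).2 hMs
  have hdm : M = q * s + t := by rw [hqM, htM, mul_comm]; exact (Nat.div_add_mod M s).symm
  have hts : t < s := htM ▸ Nat.mod_lt _ (by omega)
  have hq : q = max 1 (M / s) := by omega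
  rcases Nat.eq_zero_or_pos t with ht0 | ht
  · rw [ht0] at hdm
    obtain ⟨hgr, hA, -, hiso, -, -⟩ := almostSeesaw_extremal hr hs0 hs1 hs2 hM1 hq hdm
      (by omega) (q' := q) (by omega) (by omega) hdm (by omega)
    refine exists_isUniqueExtremizer_fin (G := almostSeesaw r (q + 2) s 0)
      ⟨⟨hA, fun W _ H hH => ?_⟩, fun W _ H hH => (hiso W H hH).elim id id⟩
    have := hgr.2 ⟨W, _, H, hH, rfl⟩
    rwa [max_self] at this
  · have hmul : (q + 1) * s = q * s + s := by ring
    have hMq' : M = (q + 1) * (s - 1) + (q + 1 - (s - t)) := by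
      have : (q + 1) * (s - 1) + (q + 1) = (q + 1) * s := by
        rw [← Nat.mul_succ]
        congr 1
        omega
      omega
    obtain ⟨-, -, -, -, h1, h2⟩ := almostSeesaw_extremal hr hs0 hs1 hs2 hM1 hq hdm
      (by omega) (q' := q + 1) (by omega) (by omega) hMq' (by omega)
    rcases lt_or_gt_of_ne (hN q t hsq ht hts (hdm ▸ hMN)) with h | h
    · exact exists_isUniqueExtremizer_fin (h2 h)
    · exact exists_isUniqueExtremizer_fin (h1 h)

end Main

theorem theorem1p2 (r : ℕ) (hr : 1 ≤ r) :
    (∀ n M : ℕ, 2 * r + 2 ≤ n → M = n - 2 * r - 2 →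
      (M = 0 → IsUniqueExtremizer n (2 * r + 1) (SimpleGraph.pathGraph (2 * r + 2))) ∧
      (1 ≤ M → ∀ s qm qp cm tm cp tp : ℕ,
        s = ⌈(r : ℚ) / 2⌉₊ →
        qm = max 1 ⌊(M : ℚ) / (s : ℚ)⌋₊ →
        qp = ⌈(M : ℚ) / (s : ℚ)⌉₊ →
        M = qm * cm + tm → tm < qm →
        M = qp * cp + tp → tp < qp →
        -- the maximal value
        IsGreatest
          {x : ℝ | ∃ (V : Type) (_ : Fintype V) (G : SimpleGraph V),
            IsTreeOfOrderDiam n (2 * r + 1) G ∧ steklovLambda2 G = x}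
          (max (steklovLambda2 (almostSeesaw r (qm + 2) cm tm))
            (steklovLambda2 (almostSeesaw r (qp + 2) cp tp))) ∧
        -- both candidates are trees of order `n` and diameter `2 * r + 1`
        IsTreeOfOrderDiam n (2 * r + 1) (almostSeesaw r (qm + 2) cm tm) ∧
        IsTreeOfOrderDiam n (2 * r + 1) (almostSeesaw r (qp + 2) cp tp) ∧
        -- every maximizer is one of the two candidates
        (∀ (V : Type) [Fintype V] (G : SimpleGraph V), IsExtremizer n (2 * r + 1) G →
          Nonempty (G ≃g almostSeesaw r (qm + 2) cm tm) ∨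
          Nonempty (G ≃g almostSeesaw r (qp + 2) cp tp)) ∧
        -- uniqueness when the two values differ
        (steklovLambda2 (almostSeesaw r (qp + 2) cp tp) <
            steklovLambda2 (almostSeesaw r (qm + 2) cm tm) →
          IsUniqueExtremizer n (2 * r + 1) (almostSeesaw r (qm + 2) cm tm)) ∧
        (steklovLambda2 (almostSeesaw r (qm + 2) cm tm) <
            steklovLambda2 (almostSeesaw r (qp + 2) cp tp) →
          IsUniqueExtremizer n (2 * r + 1) (almostSeesaw r (qp + 2) cp tp)))) ∧
    -- uniqueness for all sufficiently large orders
    ∃ N : ℕ, ∀ n : ℕ, N ≤ n →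
      ∃ H : SimpleGraph (Fin n), IsUniqueExtremizer n (2 * r + 1) H := by
  -- The ceiling enters only through r ≤ 2s ≤ r + 1.
  have hs2 : 2 * ⌈(r : ℚ) / 2⌉₊ ≤ r + 1 := by
    have h := Nat.ceil_lt_add_one (a := (r : ℚ) / 2) (by positivity)
    have : (2 * ⌈(r : ℚ) / 2⌉₊ : ℚ) < r + 2 := by linarith
    have : 2 * ⌈(r : ℚ) / 2⌉₊ < r + 2 := by exact_mod_cast this
    omega
  have hs1 : r ≤ 2 * ⌈(r : ℚ) / 2⌉₊ := by
    have h := Nat.le_ceil ((r : ℚ) / 2)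
    have : (r : ℚ) ≤ 2 * ⌈(r : ℚ) / 2⌉₊ := by linarith
    exact_mod_cast this
  have hs0 : 1 ≤ ⌈(r : ℚ) / 2⌉₊ := by omega
  refine ⟨fun n M hn hM => ⟨fun hM0 => ?_, fun hM1 s qm qp cm tm cp tp hs hqm hqp hm htm hp htp =>
    ?_⟩, ?_⟩
  · obtain rfl : n = 2 * r + 2 := by omega
    exact path_isUniqueExtremizer hr
  · obtain rfl : n = 2 * r + 2 + M := by omega
    rw [← hs] at hs0 hs1 hs2
    have hs0' : (0 : ℚ) < s := by exact_mod_cast hs0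
    rw [Nat.floor_div_eq_div] at hqm
    have hqp1 : M ≤ qp * s := by
      have h := Nat.le_ceil ((M : ℚ) / s)
      rw [← hqp, div_le_iff₀ hs0'] at h
      exact_mod_cast h
    have hqp2 : qp * s < M + s := by
      have h := Nat.ceil_lt_add_one (a := (M : ℚ) / s) (by positivity)
      rw [← hqp, ← sub_lt_iff_lt_add, lt_div_iff₀ hs0'] at h
      have : (qp * s : ℚ) < M + s := by linarith
      exact_mod_cast this
    exact almostSeesaw_extremal hr hs0 hs1 hs2 hM1 hqm hm htm hqp1 hqp2 hp htp
  · obtain ⟨N, hN⟩ := exists_unique_extremizer_of_large hr hs0 hs1 hs2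
    refine ⟨2 * r + 2 + N, fun n hn => ?_⟩
    obtain ⟨M, rfl⟩ := Nat.exists_eq_add_of_le ((Nat.le_add_right _ N).trans hn)
    exact hN M (by omega)
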